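/- **Setting.** A *cube* is a cube $Q\subset\mathbb R^n$ of positive side length with sides parallel to the coordinate axes; $|Q|$ is its Lebesgue measure and $f_Q=|Q|^{-1}\int_Q f(x)\,dx$. A *weight* is a nonnegative locally integrable function $\mu$ on $\mathbb R^n$ with $0<\mu<\infty$ a.e.; $\mu(Q)=\int_Q\mu(x)\,dx$, and $\mu\in A_1$ means that there is $C>0$ such that $\frac1{|Q|}\int_Q\mu(y)\,dy\le C\mu(x)$ for every cube $Q$ and a.e. $x\in Q$. Write $$M(f)(x)=\sup_{Q\ni x}\frac1{|Q|}\int_Q|f(y)|\,dy,\qquad M_{Q_0}(f)(x)=\sup_{Q_0\supseteq Q\ni x}\frac1{|Q|}\int_Q|f(y)|\,dy,$$ the suprema being over cubes $Q$, and $[b,M](f)(x)=b(x)M(f)(x)-M(bf)(x)$ (with values in $[-\infty,\infty]$; a point where the difference is $\infty-\infty$ is counted as a point where it is infinite). For $0<\beta<1$, $\mathrm{Lip}_{\beta,\mu}$ is the space of locally integrable $f$ with $$\sup_Q\frac1{\mu(Q)^{\beta/n}}\,\frac1{\mu(Q)}\int_Q|f(x)-f_Q|\,dx<\infty .$$ For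 $1\le p<\infty$, $0<\kappa<1$ and weights $u,v$, the weighted Morrey space $L^{p,\kappa}(u,v)$ consists of the measurable $f\in L^p_{\mathrm{loc}}(u)$ with $$\|f\|_{L^{p,\kappa}(u,v)}=\sup_Q\Big(\frac1{v(Q)^{\kappa}}\int_Q|f(x)|^pu(x)\,dx\Big)^{1/p}<\infty,$$ and $L^{p,\kappa}(\mu)=L^{p,\kappa}(\mu,\mu)$. An operator $T$, not necessarily linear, is bounded from one such space $X$ to another such space $Y$ if there is $C>0$ such that $Tf\in Y$ and $\|Tf\|_Y\le C\|f\|_X$ for all real-valued $f\in X$. **Theorem 1.2.** Let $b$ be a locally integrable real-valued function on $\mathbb R^n$, $\mu\in A_1$ and $0<\beta<1$. Suppose that $1<p<n/\beta$, $1/q=1/p-\beta/n$ and $0<\kappa<p/q$. Then the following assertions are equivalent: (1) $b\in \mathrm{Lip}_{\beta,\mu}$ and $b\ge 0$ a.e. in $\mathbb R^n$. (2) $[b,M]$ is bounded from $L^{p,\kappa}(\mu)$ to $L^{q,\kappa q/p}(\mu^{1-q},\mu)$. (3) There exists a constant $C>0$ such that $$\sup_Q\frac1{\mu(Q)^{\beta/n}}\Big(\frac1{\mu(Q)}\int_Q|b(x)-M_Q(b)(x)|^q\mu(x)^{1-q}\,dx\Big)^{1/q}\le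 C,$$ where the supremum is over all cubes $Q\subset\mathbb R^n$. -/

import Mathlib

open MeasureTheory
open scoped ENNReal NNReal

noncomputable section

namespace WeightedMorrey

variable {n : ℕ}

/-- The (nondegenerate, closed) cubes in `ℝⁿ` with sides parallel to the coordinate axes. The
distance of `Fin n → ℝ` is the sup-distance, so the closed ball with centre `c` and radius `r` is
the cube with centre `c` and side length `2 * r`; see `mem_closedBall_iff_forall_abs`. -/
def IsCube (Q : Set (Fin n → ℝ)) : Prop :=
  ∃ (c : Fin n → ℝ) (r : ℝ), 0 < r ∧ Q = Metric.closedBall c r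

theorem mem_closedBall_iff_forall_abs (c x : Fin n → ℝ) {r : ℝ} (hr : 0 < r) :
    x ∈ Metric.closedBall c r ↔ ∀ i, |x i - c i| ≤ r := by
  rw [Metric.mem_closedBall, dist_pi_le_iff hr.le]
  simp only [Real.dist_eq]

/-- A weight: a nonnegative locally integrable function with values in `(0, ∞)` almost
everywhere. -/
structure IsWeight (μ : (Fin n → ℝ) → ℝ) : Prop where
  nonneg : ∀ x, 0 ≤ μ x
  locallyIntegrable : LocallyIntegrable μ volume
  ae_pos : ∀ᵐ x, 0 < μ x

/-- The Muckenhoupt class `A₁`. -/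
structure IsA1 (μ : (Fin n → ℝ) → ℝ) : Prop where
  isWeight : IsWeight μ
  exists_const : ∃ C : ℝ, 0 < C ∧ ∀ Q : Set (Fin n → ℝ), IsCube Q →
    ∀ᵐ x ∂(volume.restrict Q), ⨍ y in Q, μ y ≤ C * μ x

/-- `μ(Q) = ∫_Q μ(x) dx`. -/
def weightMeasure (μ : (Fin n → ℝ) → ℝ) (Q : Set (Fin n → ℝ)) : ℝ≥0∞ :=
  ∫⁻ x in Q, ENNReal.ofReal (μ x)

/-- The Hardy-Littlewood maximal function
`M(f)(x) = sup_{Q ∋ x} |Q|⁻¹ ∫_Q |f(y)| dy`, with values in `[0, ∞]`. -/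
def maximalFunction (f : (Fin n → ℝ) → ℝ) (x : Fin n → ℝ) : ℝ≥0∞ :=
  ⨆ (Q : Set (Fin n → ℝ)) (_ : IsCube Q) (_ : x ∈ Q), (∫⁻ y in Q, ‖f y‖ₑ) / volume Q

/-- The local maximal function with respect to `Q₀`: the supremum is over the cubes
`Q ⊆ Q₀` that contain `x`. -/
def localMaximalFunction (Q₀ : Set (Fin n → ℝ)) (f : (Fin n → ℝ) → ℝ) (x : Fin n → ℝ) : ℝ≥0∞ :=
  ⨆ (Q : Set (Fin n → ℝ)) (_ : IsCube Q) (_ : Q ⊆ Q₀) (_ : x ∈ Q),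
    (∫⁻ y in Q, ‖f y‖ₑ) / volume Q

/-- The nonlinear commutator `[b, M](f) = b M(f) - M(b f)`, with values in `[-∞, ∞]`.
The subtraction of `EReal` gives `⊤ - ⊤ = ⊥`, so a point where the difference is undefined
counts as a point where the commutator is infinite. -/
def maximalCommutator (b f : (Fin n → ℝ) → ℝ) (x : Fin n → ℝ) : EReal :=
  (b x : EReal) * (maximalFunction f x : EReal)
    - (maximalFunction (fun y => b y * f y) x : EReal)

/-- The weighted Morrey norm
`sup_Q (v(Q)^(-κ) ∫_Q |g(x)|^p u(x) dx)^(1/p)`, with values in `[0, ∞]`. -/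
def morreyNorm (p κ : ℝ) (u v : (Fin n → ℝ) → ℝ) (g : (Fin n → ℝ) → EReal) : ℝ≥0∞ :=
  ⨆ (Q : Set (Fin n → ℝ)) (_ : IsCube Q),
    ((∫⁻ x in Q, (g x).abs ^ p * ENNReal.ofReal (u x)) / weightMeasure v Q ^ κ) ^ (1 / p)

/-- The weighted Morrey space `L^{p,κ}(u, v)`: the measurable functions that belong to
`L^p_loc(u)` and have finite Morrey norm. -/
structure MemMorrey (p κ : ℝ) (u v : (Fin n → ℝ) → ℝ) (g : (Fin n → ℝ) → EReal) : Prop where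
  aemeasurable : AEMeasurable g volume
  memLp_loc : ∀ K : Set (Fin n → ℝ), IsCompact K →
    ∫⁻ x in K, (g x).abs ^ p * ENNReal.ofReal (u x) < ∞
  norm_lt_top : morreyNorm p κ u v g < ∞

/-- The (not necessarily linear) operator `T` is bounded from `L^{p,κ}(u, v)` to
`L^{p',κ'}(u', v')`. -/
def BoundedOnMorrey (T : ((Fin n → ℝ) → ℝ) → (Fin n → ℝ) → EReal)
    (p κ : ℝ) (u v : (Fin n → ℝ) → ℝ) (p' κ' : ℝ) (u' v' : (Fin n → ℝ) → ℝ) : Prop :=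
  ∃ C : ℝ≥0, 0 < C ∧ ∀ f : (Fin n → ℝ) → ℝ, MemMorrey p κ u v (fun x => (f x : EReal)) →
    MemMorrey p' κ' u' v' (T f) ∧
    morreyNorm p' κ' u' v' (T f) ≤ C * morreyNorm p κ u v (fun x => (f x : EReal))

/-- The normalized weighted `L^s` size of `g` on `Q`:
`μ(Q)^(-β/n) (μ(Q)⁻¹ ∫_Q |g(x)|^s μ(x)^(1-s) dx)^(1/s)`. -/
def normalizedSize (β s : ℝ) (μ : (Fin n → ℝ) → ℝ) (Q : Set (Fin n → ℝ))
    (g : (Fin n → ℝ) → EReal) : ℝ≥0∞ :=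
  ((∫⁻ x in Q, (g x).abs ^ s * ENNReal.ofReal (μ x ^ (1 - s))) / weightMeasure μ Q) ^ (1 / s)
    / weightMeasure μ Q ^ (β / n)

/-- The weighted Lipschitz seminorm of `Lip^s_{β,μ}`, `1 ≤ s < ∞`: the supremum over all cubes of
the normalized weighted `L^s` size of `f - f_Q` on `Q`. -/
def lipNorm (β s : ℝ) (μ f : (Fin n → ℝ) → ℝ) : ℝ≥0∞ :=
  ⨆ (Q : Set (Fin n → ℝ)) (_ : IsCube Q),
    normalizedSize β s μ Q (fun x => ((f x - ⨍ y in Q, f y : ℝ) : EReal))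

/-- The weighted Lipschitz space `Lip_{β,μ} = Lip^1_{β,μ}`. -/
def MemLip (β : ℝ) (μ f : (Fin n → ℝ) → ℝ) : Prop :=
  LocallyIntegrable f volume ∧ lipNorm β 1 μ f < ∞

end WeightedMorrey

end

/-!
The three assertions are proved equivalent in a cycle. All estimates are made for the measure
`μ(x) dx` (`weightedVolume μ`), which by the `A₁` condition is doubling on cubes
(`A1Bound.isDoublingOnCubes`), and reverse doubling (`A1Bound.exists_reverse_doubling`).

From a nonnegative weighted Lipschitz function to the commutator: summing the differences of the
averages of `b` over cubes that shrink to `x`, which decay geometrically by reverse doubling, gives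
`|b(x) - b_Q| ≲ μ(x) μ(Q)^(β/n)` for almost every `x ∈ Q`
(`A1Bound.exists_enorm_sub_setAverage_le`).
Since `b ≥ 0`, the commutator at `x` is at most the supremum over cubes `Q ∋ x` of the averages of
`|b(x) - b| |f|`, wherever `M(f)` is finite; with the `A₁` condition this is
`≲ μ(x) M_{β/n} f(x)`, where `M_{β/n}` is the fractional maximal function with respect to `μ(x) dx`
(`A1Bound.exists_abs_maximalCommutator_le`). It remains to bound `M_{β/n}` between Morrey spaces
(`IsDoublingOnCubes.exists_lintegral_fractionalMaximal_rpow_le`). On a cube `Q`, the cubes not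
larger than `Q` only see `f` on the triple of `Q` and are treated by Hedberg's inequality and the
Hardy-Littlewood maximal theorem, which is proved here from Vitali's covering lemma and the
layer-cake formula; the larger cubes are treated by Hölder's inequality, and here `κ < p / q` is
used. The case of exponent zero of the same bound shows that `M(f)` is finite almost everywhere.

From the commutator to `b - M_Q(b)`: on a cube `Q`, the commutator applied to `χ_Q` equals
`b - M_Q(b)` (`IsCube.maximalCommutator_indicator`), and the Morrey norm of `χ_Q` is at most
`μ(Q)^((1-κ)/p)`.

From `b - M_Q(b)` to the Lipschitz condition: both `b_Q ≤ M_Q(b)` and `0 ≤ M_Q(b)` hold on `Q`, so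
that `|b - M_Q(b)|` dominates the positive part of `b_Q - b`, whose integral over `Q` is half of
that of `|b - b_Q|`, and the negative part of `b`. Hölder's inequality turns the assumed `L^q` bound
into an `L^1` bound of order `μ(Q)^(1+β/n)`; divided by `|Q|` it tends to zero as `Q` shrinks to a point,
so that the negative part of `b` vanishes (`memLip_and_nonneg_of_normalizedSize_le`).
-/

namespace WeightedMorrey

open Metric Set

variable {n : ℕ}

/-! ### Geometry of cubes -/

theorem isCube_closedBall (c : Fin n → ℝ) {r : ℝ} (hr : 0 < r) : IsCube (closedBall c r) :=
  ⟨c, r, hr, rfl⟩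

theorem IsCube.measurableSet {Q : Set (Fin n → ℝ)} (hQ : IsCube Q) : MeasurableSet Q := by
  obtain ⟨c, r, -, rfl⟩ := hQ
  exact measurableSet_closedBall

theorem IsCube.isCompact {Q : Set (Fin n → ℝ)} (hQ : IsCube Q) : IsCompact Q := by
  obtain ⟨c, r, -, rfl⟩ := hQ
  exact isCompact_closedBall c r

theorem IsCube.volume_ne_zero {Q : Set (Fin n → ℝ)} (hQ : IsCube Q) : volume Q ≠ 0 := by
  obtain ⟨c, r, hr, rfl⟩ := hQ
  exact (measure_closedBall_pos volume c hr).ne'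

theorem IsCube.volume_ne_top {Q : Set (Fin n → ℝ)} (hQ : IsCube Q) : volume Q ≠ ∞ :=
  hQ.isCompact.measure_lt_top.ne

theorem volume_closedBall_mul (c d : Fin n → ℝ) {r k : ℝ} (hr : 0 ≤ r) (hk : 0 ≤ k) :
    volume (closedBall c (k * r)) = ENNReal.ofReal (k ^ n) * volume (closedBall d r) := by
  rw [Real.volume_pi_closedBall _ (by positivity), Real.volume_pi_closedBall _ hr,
    ← ENNReal.ofReal_mul (by positivity), Fintype.card_fin, ← mul_pow]
  congr 2
  ring

/-- Two cubes that meet are comparable: the smaller one lies in the triple of the larger one. -/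
theorem closedBall_subset_triple {c d x : Fin n → ℝ} {r s : ℝ} (hs : s ≤ r)
    (hxc : x ∈ closedBall c r) (hxd : x ∈ closedBall d s) :
    closedBall d s ⊆ closedBall c (3 * r) := by
  refine closedBall_subset_closedBall' ?_
  have h1 := mem_closedBall'.1 hxd
  have h2 := mem_closedBall.1 hxc
  linarith [dist_triangle d x c]

/-- A cube cannot meet both of two opposite faces of a cube four times its size, so that some
cube of the same size inside the large one is disjoint from it. -/
theorem exists_closedBall_quarter_disjoint (i : Fin n) (c d : Fin n → ℝ) {r : ℝ} (hr : 0 < r) :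
    ∃ e : Fin n → ℝ, closedBall e (r / 4) ⊆ closedBall c r ∧
      Disjoint (closedBall e (r / 4)) (closedBall d (r / 4)) := by
  have hr4 : 0 < r / 4 := by positivity
  obtain ⟨σ, hσ, hσ'⟩ : ∃ σ : ℝ, |σ| = 3 * r / 4 ∧ r / 2 < |c i + σ - d i| := by
    rcases le_total (d i) (c i) with h | h
    · exact ⟨3 * r / 4, abs_of_pos (by positivity), lt_of_lt_of_le (by linarith) (le_abs_self _)⟩
    · exact ⟨-(3 * r / 4), by rw [abs_neg, abs_of_pos (by positivity)],
        lt_of_lt_of_le (by linarith) (neg_le_abs _)⟩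
  refine ⟨Function.update c i (c i + σ), ?_, ?_⟩
  · refine closedBall_subset_closedBall' ?_
    have : dist (Function.update c i (c i + σ)) c ≤ 3 * r / 4 := by
      rw [dist_pi_le_iff (by positivity)]
      intro j
      by_cases hj : j = i
      · subst hj
        simp [hσ]
      · simp [Function.update_of_ne hj]
        positivity
    linarith
  · rw [Set.disjoint_left]
    intro y hy hy'
    have h1 := (mem_closedBall_iff_forall_abs _ _ hr4).1 hy i
    have h2 := (mem_closedBall_iff_forall_abs _ _ hr4).1 hy' i
    rw [Function.update_self] at h1
    have := abs_sub_le (c i + σ) (y i) (d i)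
    rw [abs_sub_comm (c i + σ) (y i)] at this
    linarith

/-- The trace of a cube `Q` on a cube `Q₀` that it meets is contained in a cube inside `Q₀` that
is not larger than `Q`: clamp the centre of `Q`. -/
theorem exists_isCube_subset_of_inter {Q₀ Q : Set (Fin n → ℝ)} (hQ₀ : IsCube Q₀) (hQ : IsCube Q) :
    ∃ P : Set (Fin n → ℝ), IsCube P ∧ P ⊆ Q₀ ∧ Q ∩ Q₀ ⊆ P ∧ volume P ≤ volume Q := by
  obtain ⟨c₀, r₀, hr₀, rfl⟩ := hQ₀
  obtain ⟨c, r, hr, rfl⟩ := hQ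
  rcases le_total r₀ r with h | h
  · refine ⟨closedBall c₀ r₀, isCube_closedBall _ hr₀, Subset.rfl, inter_subset_right, ?_⟩
    rw [Real.volume_pi_closedBall _ hr₀.le, Real.volume_pi_closedBall _ hr.le]
    gcongr
  · refine ⟨closedBall (fun i => max (c₀ i - (r₀ - r)) (min (c i) (c₀ i + (r₀ - r)))) r,
      isCube_closedBall _ hr, ?_, ?_, ?_⟩
    · intro y hy
      rw [mem_closedBall_iff_forall_abs _ _ hr] at hy
      rw [mem_closedBall_iff_forall_abs _ _ hr₀]
      intro i
      have := hy i
      rw [abs_le] at this ⊢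
      rcases max_cases (c₀ i - (r₀ - r)) (min (c i) (c₀ i + (r₀ - r))) with h1 | h1 <;>
      rcases min_cases (c i) (c₀ i + (r₀ - r)) with h2 | h2 <;>
      constructor <;> linarith
    · rintro y ⟨hy, hy'⟩
      rw [mem_closedBall_iff_forall_abs _ _ hr] at hy ⊢
      rw [mem_closedBall_iff_forall_abs _ _ hr₀] at hy'
      intro i
      have h3 := hy i
      have h4 := hy' i
      rw [abs_le] at h3 h4 ⊢
      rcases max_cases (c₀ i - (r₀ - r)) (min (c i) (c₀ i + (r₀ - r))) with h1 | h1 <;>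
      rcases min_cases (c i) (c₀ i + (r₀ - r)) with h2 | h2 <;>
      constructor <;> linarith
    · rw [Real.volume_pi_closedBall _ hr.le, Real.volume_pi_closedBall _ hr.le]

/-- The image of the cube `closedBall c r` under the homothety with centre `x` and ratio
`4 ^ (-k)`. If the cube contains `x`, these cubes shrink to `x` and are nested. -/
def shrunkCube (c x : Fin n → ℝ) (r : ℝ) (k : ℕ) : Set (Fin n → ℝ) :=
  closedBall (x + (1 / 4 : ℝ) ^ k • (c - x)) ((1 / 4 : ℝ) ^ k * r)

theorem shrunkCube_zero (c x : Fin n → ℝ) (r : ℝ) : shrunkCube c x r 0 = closedBall c r := by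
  simp [shrunkCube]

theorem isCube_shrunkCube (c x : Fin n → ℝ) {r : ℝ} (hr : 0 < r) (k : ℕ) :
    IsCube (shrunkCube c x r k) :=
  isCube_closedBall _ (by positivity)

theorem mem_shrunkCube {c x : Fin n → ℝ} {r : ℝ} (hx : x ∈ closedBall c r) (k : ℕ) :
    x ∈ shrunkCube c x r k := by
  rw [shrunkCube, mem_closedBall', dist_eq_norm, add_sub_cancel_left, norm_smul,
    Real.norm_of_nonneg (by positivity)]
  rw [mem_closedBall', dist_eq_norm] at hx
  gcongr

theorem shrunkCube_succ_subset {c x : Fin n → ℝ} {r : ℝ} (hx : x ∈ closedBall c r) (k : ℕ) :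
    shrunkCube c x r (k + 1) ⊆ shrunkCube c x r k := by
  refine closedBall_subset_closedBall' ?_
  have h : x + (1 / 4 : ℝ) ^ (k + 1) • (c - x) - (x + (1 / 4 : ℝ) ^ k • (c - x))
      = -((3 / 4 * (1 / 4 : ℝ) ^ k) • (c - x)) := by
    ext i
    simp [pow_succ]
    ring
  rw [mem_closedBall', dist_eq_norm] at hx
  rw [dist_eq_norm, h, norm_neg, norm_smul, Real.norm_of_nonneg (by positivity)]
  calc (1 / 4 : ℝ) ^ (k + 1) * r + 3 / 4 * (1 / 4 : ℝ) ^ k * ‖c - x‖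
      ≤ (1 / 4 : ℝ) ^ (k + 1) * r + 3 / 4 * (1 / 4 : ℝ) ^ k * r := by gcongr
    _ = (1 / 4 : ℝ) ^ k * r := by rw [pow_succ]; ring

theorem shrunkCube_subset {c x : Fin n → ℝ} {r : ℝ} (hx : x ∈ closedBall c r) (k : ℕ) :
    shrunkCube c x r k ⊆ closedBall c r := by
  have := antitone_nat_of_succ_le (shrunkCube_succ_subset hx) (Nat.zero_le k)
  rwa [shrunkCube_zero] at this

theorem volume_shrunkCube_succ (c x : Fin n → ℝ) {r : ℝ} (hr : 0 < r) (k : ℕ) :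
    volume (shrunkCube c x r k) = ENNReal.ofReal (4 ^ n) * volume (shrunkCube c x r (k + 1)) := by
  rw [shrunkCube, shrunkCube, ← volume_closedBall_mul _ _ (by positivity) (by norm_num)]
  congr 2
  rw [pow_succ]
  ring

/-- **Lebesgue differentiation** along the cubes that shrink to a point. -/
theorem ae_tendsto_average_shrunkCube {f : (Fin n → ℝ) → ℝ} (hf : LocallyIntegrable f volume) :
    ∀ᵐ x, ∀ (c : Fin n → ℝ) (r : ℝ), 0 < r → x ∈ closedBall c r →
      Filter.Tendsto (fun k => ⨍ y in shrunkCube c x r k, f y) Filter.atTop (nhds (f x)) := by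
  filter_upwards [IsUnifLocDoublingMeasure.ae_tendsto_average volume hf 1] with x hx c r hr hxr
  refine hx _ _ ?_ (Filter.Eventually.of_forall fun k => ?_)
  · refine tendsto_nhdsWithin_iff.2 ⟨?_, Filter.Eventually.of_forall fun k => ?_⟩
    · simpa using (tendsto_pow_atTop_nhds_zero_of_lt_one (r := (1 / 4 : ℝ)) (by norm_num)
        (by norm_num)).mul_const r
    · exact mem_Ioi.2 (by positivity)
  · rw [one_mul]
    exact mem_shrunkCube hxr k

/-! ### Maximal functions for doubling measures -/

/-- The maximal function of `g ≥ 0` with respect to `ν` over the cubes of radius less than `R`.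
The strict bound on the radius makes it lower semicontinuous. -/
noncomputable def truncatedMaximal (ν : Measure (Fin n → ℝ)) (R : ℝ) (g : (Fin n → ℝ) → ℝ≥0∞)
    (x : Fin n → ℝ) : ℝ≥0∞ :=
  ⨆ (c : Fin n → ℝ) (r : ℝ) (_ : 0 < r) (_ : r < R) (_ : x ∈ closedBall c r),
    (∫⁻ y in closedBall c r, g y ∂ν) / ν (closedBall c r)

/-- The fractional maximal function `sup_{Q ∋ x} ν(Q)^α ν(Q)⁻¹ ∫_Q g dν` of `g ≥ 0`. -/
noncomputable def fractionalMaximal (ν : Measure (Fin n → ℝ)) (α : ℝ) (g : (Fin n → ℝ) → ℝ≥0∞)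
    (x : Fin n → ℝ) : ℝ≥0∞ :=
  ⨆ (c : Fin n → ℝ) (r : ℝ) (_ : 0 < r) (_ : x ∈ closedBall c r),
    ν (closedBall c r) ^ α * ((∫⁻ y in closedBall c r, g y ∂ν) / ν (closedBall c r))

/-- A measure that is positive, finite and doubling, with constant `D`, on cubes. -/
structure IsDoublingOnCubes (ν : Measure (Fin n → ℝ)) (D : ℝ≥0) : Prop where
  ne_zero : ∀ (c : Fin n → ℝ) (r : ℝ), 0 < r → ν (closedBall c r) ≠ 0
  ne_top : ∀ (c : Fin n → ℝ) (r : ℝ), ν (closedBall c r) ≠ ∞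
  le_mul : ∀ (c : Fin n → ℝ) (r : ℝ), 0 < r → ν (closedBall c (5 * r)) ≤ D * ν (closedBall c r)

theorem le_truncatedMaximal (ν : Measure (Fin n → ℝ)) {R : ℝ} (g : (Fin n → ℝ) → ℝ≥0∞)
    {c x : Fin n → ℝ} {r : ℝ} (hr : 0 < r) (hrR : r < R) (hx : x ∈ closedBall c r) :
    (∫⁻ y in closedBall c r, g y ∂ν) / ν (closedBall c r) ≤ truncatedMaximal ν R g x := by
  unfold truncatedMaximal
  exact le_iSup₂_of_le c r <| le_iSup₂_of_le hr hrR <| le_iSup_of_le hx le_rfl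

theorem le_fractionalMaximal (ν : Measure (Fin n → ℝ)) (α : ℝ) (g : (Fin n → ℝ) → ℝ≥0∞)
    {c x : Fin n → ℝ} {r : ℝ} (hr : 0 < r) (hx : x ∈ closedBall c r) :
    ν (closedBall c r) ^ α * ((∫⁻ y in closedBall c r, g y ∂ν) / ν (closedBall c r))
      ≤ fractionalMaximal ν α g x := by
  unfold fractionalMaximal
  exact le_iSup₂_of_le c r <| le_iSup₂_of_le hr hx le_rfl

theorem exists_of_lt_truncatedMaximal {ν : Measure (Fin n → ℝ)} {R : ℝ}
    {g : (Fin n → ℝ) → ℝ≥0∞} {x : Fin n → ℝ} {t : ℝ≥0∞} (h : t < truncatedMaximal ν R g x) :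
    ∃ (c : Fin n → ℝ) (r : ℝ), 0 < r ∧ r < R ∧ x ∈ closedBall c r ∧
      t < (∫⁻ y in closedBall c r, g y ∂ν) / ν (closedBall c r) := by
  simpa only [truncatedMaximal, lt_iSup_iff, exists_prop] using h

/-- An average over a closed cube that exceeds `t` still does so over a slightly larger concentric
cube, which is a neighbourhood of the original one. -/
theorem lowerSemicontinuous_truncatedMaximal {ν : Measure (Fin n → ℝ)}
    (hν : ∀ (c : Fin n → ℝ) (r : ℝ), ν (closedBall c r) ≠ ∞)
    (R : ℝ) (g : (Fin n → ℝ) → ℝ≥0∞) : LowerSemicontinuous (truncatedMaximal ν R g) := by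
  intro x t ht
  obtain ⟨c, r, hr, hrR, hx, hlt⟩ := exists_of_lt_truncatedMaximal ht
  have hlim : Filter.Tendsto (fun ε : ℝ => ν (closedBall c (r + ε))) (nhdsWithin 0 (Ioi 0))
      (nhds (ν (closedBall c r))) := by
    have h := tendsto_measure_biInter_gt (μ := ν) (ι := ℝ) (a := r) (s := fun s => closedBall c s)
      (fun s _ => measurableSet_closedBall.nullMeasurableSet)
      (fun i j _ hij => closedBall_subset_closedBall hij) ⟨r + 1, by linarith, hν _ _⟩
    have hI : ⋂ s > r, closedBall c s = closedBall c r := by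
      ext y
      simp only [mem_iInter, mem_closedBall]
      exact ⟨fun h => le_of_forall_gt_imp_ge_of_dense h, fun h s hs => h.trans hs.le⟩
    rw [hI] at h
    refine h.comp (tendsto_nhdsWithin_iff.2 ⟨?_, ?_⟩)
    · refine Filter.Tendsto.mono_left ?_ nhdsWithin_le_nhds
      simpa using (Filter.tendsto_id (x := nhds (0 : ℝ))).const_add r
    · filter_upwards [self_mem_nhdsWithin] with ε hε
      simpa using hε
  have hlim' : Filter.Tendsto
      (fun ε : ℝ => (∫⁻ y in closedBall c r, g y ∂ν) / ν (closedBall c (r + ε)))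
      (nhdsWithin 0 (Ioi 0)) (nhds ((∫⁻ y in closedBall c r, g y ∂ν) / ν (closedBall c r))) :=
    ENNReal.Tendsto.const_div hlim (Or.inl (hν _ _))
  have hR : ∀ᶠ ε : ℝ in nhdsWithin 0 (Ioi 0), ε < R - r :=
    nhdsWithin_le_nhds (Iio_mem_nhds (by linarith))
  obtain ⟨ε, hε, hε', hε0⟩ :=
    ((hlim'.eventually (lt_mem_nhds hlt)).and (hR.and self_mem_nhdsWithin)).exists
  have hε0 : 0 < ε := hε0
  filter_upwards [closedBall_mem_nhds x hε0] with y hy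
  have hy' : y ∈ closedBall c (r + ε) := by
    rw [mem_closedBall] at hx hy ⊢
    linarith [dist_triangle y x c]
  refine lt_of_lt_of_le (hε.trans_le ?_)
    (le_truncatedMaximal ν g (by positivity : 0 < r + ε) (by linarith) hy')
  gcongr
  linarith

theorem truncatedMaximal_le_indicator_add {ν : Measure (Fin n → ℝ)} (R : ℝ)
    (g : (Fin n → ℝ) → ℝ≥0∞) (s : ℝ≥0∞) (x : Fin n → ℝ) :
    truncatedMaximal ν R g x ≤ truncatedMaximal ν R ({y | s < g y}.indicator g) x + s := by
  rw [truncatedMaximal]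
  refine iSup₂_le fun c r => iSup₂_le fun hr hrR => iSup_le fun hx => ?_
  refine le_trans ?_ (add_le_add_left (le_truncatedMaximal ν _ hr hrR hx) s)
  have h : ∫⁻ y in closedBall c r, g y ∂ν ≤
      ∫⁻ y in closedBall c r, {y | s < g y}.indicator g y ∂ν + s * ν (closedBall c r) := by
    rw [← setLIntegral_const, ← lintegral_add_right _ measurable_const]
    refine lintegral_mono fun y => ?_
    by_cases hy : s < g y
    · simp [indicator_of_mem (show y ∈ {y | s < g y} from hy)]
    · simp [not_lt.1 hy]
  calc _ ≤ (∫⁻ y in closedBall c r, {y | s < g y}.indicator g y ∂ν + s * ν (closedBall c r))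
        / ν (closedBall c r) := by gcongr
    _ ≤ _ := by
      rw [ENNReal.add_div]
      gcongr
      exact ENNReal.div_le_of_le_mul le_rfl

/-- **Weak type `(1, 1)`** of the maximal function, by Vitali's covering lemma. -/
theorem IsDoublingOnCubes.mul_measure_lt_truncatedMaximal_le {ν : Measure (Fin n → ℝ)} {D : ℝ≥0}
    (hν : IsDoublingOnCubes ν D) (R : ℝ) (g : (Fin n → ℝ) → ℝ≥0∞) (t : ℝ≥0∞) :
    t * ν {x | t < truncatedMaximal ν R g x} ≤ D * ∫⁻ x, g x ∂ν := by
  set E := {x | t < truncatedMaximal ν R g x}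
  choose! c r hr hrR hx hlt using fun x (hx : x ∈ E) => exists_of_lt_truncatedMaximal hx
  obtain ⟨u, huE, hdisj, hcov⟩ := Vitali.exists_disjoint_subfamily_covering_enlargement_closedBall
    E c r R (fun a ha => (hrR a ha).le) 5 (by norm_num)
  have hcount : u.Countable := by
    refine hdisj.countable_of_nonempty_interior fun a ha => ?_
    exact ⟨c a, ball_subset_interior_closedBall (mem_ball_self (hr a (huE ha)))⟩
  have hE : E ⊆ ⋃ a ∈ u, closedBall (c a) (5 * r a) := by
    intro x hxE
    obtain ⟨a, ha, hsub⟩ := hcov x hxE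
    exact mem_biUnion ha (hsub (hx x hxE))
  have := hcount.to_subtype
  calc t * ν E ≤ t * ∑' a : u, ν (closedBall (c a) (5 * r a)) := by
        gcongr
        exact (measure_mono hE).trans (measure_biUnion_le ν hcount _)
    _ = ∑' a : u, t * ν (closedBall (c a) (5 * r a)) := ENNReal.tsum_mul_left.symm
    _ ≤ ∑' a : u, D * ∫⁻ y in closedBall (c a) (r a), g y ∂ν := by
        refine ENNReal.tsum_le_tsum fun a => ?_
        have ha := huE a.2
        calc t * ν (closedBall (c a) (5 * r a)) ≤ t * (D * ν (closedBall (c a) (r a))) := by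
              gcongr
              exact hν.le_mul _ _ (hr a ha)
          _ = D * (t * ν (closedBall (c a) (r a))) := by ring
          _ ≤ D * ∫⁻ y in closedBall (c a) (r a), g y ∂ν := by
              gcongr
              exact (ENNReal.le_div_iff_mul_le (Or.inl (hν.ne_zero _ _ (hr a ha)))
                (Or.inl (hν.ne_top _ _))).1 (hlt a ha).le
    _ = D * ∑' a : u, ∫⁻ y in closedBall (c a) (r a), g y ∂ν := ENNReal.tsum_mul_left
    _ ≤ D * ∫⁻ x, g x ∂ν := by
        gcongr
        rw [← lintegral_biUnion hcount (fun _ _ => measurableSet_closedBall) hdisj]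
        exact setLIntegral_le_lintegral _ _

/-- **Strong type `(p, p)`** of the maximal function. The layer-cake formula is used twice: for
`ν`, and, with exponent `p - 1`, for the measure with density `g` with respect to `ν`. -/
theorem IsDoublingOnCubes.exists_lintegral_truncatedMaximal_rpow_le {D : ℝ≥0} {p : ℝ}
    (hp : 1 < p) : ∃ K : ℝ≥0, ∀ (ν : Measure (Fin n → ℝ)), IsDoublingOnCubes ν D →
      ∀ (R : ℝ) (g : (Fin n → ℝ) → ℝ≥0∞), Measurable g → ∫⁻ x, g x ∂ν ≠ ∞ →
        ∫⁻ x, truncatedMaximal ν R g x ^ p ∂ν ≤ K * ∫⁻ x, g x ^ p ∂ν := by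
  have hp0 : 0 < p := by linarith
  have hp1 : 0 < p - 1 := by linarith
  refine ⟨(ENNReal.ofReal p * (2 * D) * (ENNReal.ofReal (p - 1))⁻¹ * 2 ^ (p - 1)).toNNReal,
    fun ν hν R g hg hgfin => ?_⟩
  rw [ENNReal.coe_toNNReal (by
    refine ENNReal.mul_ne_top (ENNReal.mul_ne_top (ENNReal.mul_ne_top ENNReal.ofReal_ne_top
      (by finiteness)) (ENNReal.inv_ne_top.2 (by simpa using hp))) (by finiteness))]
  set N := truncatedMaximal ν R g with hN
  have hNmeas : Measurable N :=
    (lowerSemicontinuous_truncatedMaximal hν.ne_top R g).measurable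
  have hNfin : ∀ᵐ x ∂ν, N x < ∞ := by
    rw [ae_iff]
    by_contra h0
    have h1 : ∀ k : ℕ, k * ν {x | ¬ N x < ∞} ≤ D * ∫⁻ x, g x ∂ν := fun k => by
      refine le_trans ?_ (hν.mul_measure_lt_truncatedMaximal_le R g k)
      gcongr with x
      intro hx
      rw [not_lt, top_le_iff] at hx
      simp [← hN, hx]
    have h2 : (⊤ : ℝ≥0∞) ≤ D * ∫⁻ x, g x ∂ν := by
      have h3 : (⨆ k : ℕ, (k : ℝ≥0∞)) * ν {x | ¬ N x < ∞} = ⊤ := by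
        rw [ENNReal.iSup_natCast, ENNReal.top_mul h0]
      rw [ENNReal.iSup_mul] at h3
      exact h3.ge.trans (iSup_le h1)
    exact ENNReal.mul_ne_top ENNReal.coe_ne_top hgfin (top_le_iff.1 h2)
  have hgfin' : ∀ᵐ x ∂ν, g x < ∞ := ae_lt_top hg hgfin
  have hlevel : ∀ t : ℝ, 0 < t → ν {x | t < (N x).toReal} * ENNReal.ofReal (t ^ (p - 1)) ≤
      2 * D * (ν.withDensity g {x | t < (2 * g x).toReal} * ENNReal.ofReal (t ^ (p - 1 - 1))) := by
    intro t ht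
    set s : ℝ≥0∞ := ENNReal.ofReal (t / 2) with hs
    have hst : s + s = ENNReal.ofReal t := by
      rw [hs, ← ENNReal.ofReal_add (by positivity) (by positivity), add_halves]
    have h1 : s * ν {x | t < (N x).toReal} ≤ D * ν.withDensity g {x | t < (2 * g x).toReal} := by
      calc s * ν {x | t < (N x).toReal}
          ≤ s * ν {x | s < truncatedMaximal ν R ({y | s < g y}.indicator g) x} := by
            gcongr with x
            intro hx
            have h2 : s + s < N x := by
              rw [hst]
              exact (ENNReal.ofReal_lt_iff_lt_toReal ht.le
                (fun h => by simp [h] at hx; linarith)).2 hx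
            exact lt_of_add_lt_add_right
              (h2.trans_le (truncatedMaximal_le_indicator_add R g s x))
        _ ≤ D * ∫⁻ x, {y | s < g y}.indicator g x ∂ν :=
            hν.mul_measure_lt_truncatedMaximal_le _ _ _
        _ = D * ν.withDensity g {x | s < g x} := by
            rw [lintegral_indicator (measurableSet_lt measurable_const hg),
              withDensity_apply _ (measurableSet_lt measurable_const hg)]
        _ = D * ν.withDensity g {x | t < (2 * g x).toReal} := by
            congr 1
            refine measure_congr ?_
            filter_upwards [(withDensity_absolutelyContinuous ν g) hgfin'] with x hx
            refine propext (?_ : s < g x ↔ t < (2 * g x).toReal)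
            rw [hs, ENNReal.ofReal_lt_iff_lt_toReal (by positivity) hx.ne, ENNReal.toReal_mul]
            simp only [ENNReal.toReal_ofNat]
            constructor <;> intro h <;> linarith
    have h3 : ENNReal.ofReal (t ^ (p - 1)) = 2 * s * ENNReal.ofReal (t ^ (p - 1 - 1)) := by
      rw [two_mul, hst, ← ENNReal.ofReal_mul ht.le]
      congr 1
      rw [← Real.rpow_one_add' ht.le (by linarith)]
      congr 1
      ring
    calc _ = 2 * (s * ν {x | t < (N x).toReal}) * ENNReal.ofReal (t ^ (p - 1 - 1)) := by
          rw [h3]; ring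
      _ ≤ 2 * (D * ν.withDensity g {x | t < (2 * g x).toReal})
          * ENNReal.ofReal (t ^ (p - 1 - 1)) := by gcongr
      _ = _ := by ring
  have hcake : ENNReal.ofReal (p - 1) *
      ∫⁻ t in Ioi (0 : ℝ), ν.withDensity g {x | t < (2 * g x).toReal} *
        ENNReal.ofReal (t ^ (p - 1 - 1)) = 2 ^ (p - 1) * ∫⁻ x, g x ^ p ∂ν := by
    rw [← lintegral_rpow_eq_lintegral_meas_lt_mul _ (Filter.Eventually.of_forall fun x => by simp)
      (by fun_prop) hp1, lintegral_withDensity_eq_lintegral_mul _ hg (by fun_prop),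
      ← lintegral_const_mul _ (by fun_prop)]
    refine lintegral_congr_ae ?_
    filter_upwards [hgfin'] with x hx
    simp only [Pi.mul_apply]
    rw [← ENNReal.ofReal_rpow_of_nonneg ENNReal.toReal_nonneg hp1.le, ENNReal.ofReal_toReal
      (by finiteness), ENNReal.mul_rpow_of_nonneg _ _ hp1.le, mul_left_comm]
    congr 1
    nth_rewrite 1 [← ENNReal.rpow_one (g x)]
    rw [← ENNReal.rpow_add_of_nonneg _ _ zero_le_one hp1.le]
    congr 1
    ring
  have hofp : ENNReal.ofReal (p - 1) ≠ 0 := by simpa using hp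
  calc ∫⁻ x, N x ^ p ∂ν = ∫⁻ x, ENNReal.ofReal ((N x).toReal ^ p) ∂ν := by
        refine lintegral_congr_ae ?_
        filter_upwards [hNfin] with x hx
        rw [← ENNReal.ofReal_rpow_of_nonneg ENNReal.toReal_nonneg hp0.le,
          ENNReal.ofReal_toReal hx.ne]
    _ = ENNReal.ofReal p * ∫⁻ t in Ioi (0 : ℝ), ν {x | t < (N x).toReal} *
          ENNReal.ofReal (t ^ (p - 1)) :=
        lintegral_rpow_eq_lintegral_meas_lt_mul _ (Filter.Eventually.of_forall fun x => by simp)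
          (by fun_prop) hp0
    _ ≤ ENNReal.ofReal p * ∫⁻ t in Ioi (0 : ℝ), 2 * D *
          (ν.withDensity g {x | t < (2 * g x).toReal} * ENNReal.ofReal (t ^ (p - 1 - 1))) := by
        gcongr ENNReal.ofReal p * ?_
        exact setLIntegral_mono' measurableSet_Ioi hlevel
    _ = ENNReal.ofReal p * (2 * D) * (ENNReal.ofReal (p - 1))⁻¹ * (ENNReal.ofReal (p - 1) *
          ∫⁻ t in Ioi (0 : ℝ), ν.withDensity g {x | t < (2 * g x).toReal} *
          ENNReal.ofReal (t ^ (p - 1 - 1))) := by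
        rw [lintegral_const_mul' _ _ (by finiteness), ← mul_assoc _ (ENNReal.ofReal (p - 1)),
          mul_assoc _ _ (ENNReal.ofReal (p - 1)),
          ENNReal.inv_mul_cancel hofp ENNReal.ofReal_ne_top, mul_one, ← mul_assoc]
    _ = _ := by rw [hcake, ← mul_assoc]

/-! ### The fractional maximal function on Morrey spaces -/

theorem setLIntegral_le_rpow_mul_measure_rpow {X : Type*} [MeasurableSpace X] (ν : Measure X)
    {p : ℝ} (hp : 1 < p) {g : X → ℝ≥0∞} {S : Set X} (hg : AEMeasurable g (ν.restrict S)) :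
    ∫⁻ x in S, g x ∂ν ≤ (∫⁻ x in S, g x ^ p ∂ν) ^ (1 / p) * ν S ^ (1 - 1 / p) := by
  have hpq := Real.HolderConjugate.conjExponent hp
  have h := ENNReal.lintegral_mul_le_Lp_mul_Lq (ν.restrict S) hpq hg
    (aemeasurable_const (b := (1 : ℝ≥0∞)))
  have h2 : 1 / Real.conjExponent p = 1 - 1 / p := by
    have := hpq.inv_add_inv_eq_one
    simp only [one_div]
    linarith
  simpa [h2, -one_div] using h

/-- The contribution of small cubes, by Hedberg's argument: an average `A` over `Q` is at most the
maximal function and, by Hölder's inequality, at most `(ν(Q)⁻¹ ∫ g ^ p) ^ (1 / p)`. Interpolating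
between the two bounds cancels the power of `ν(Q)`. -/
theorem rpow_mul_le_of_le_of_le {V A N G : ℝ≥0∞} {p q α : ℝ} (hp : 1 < p) (hpq : p ≤ q)
    (hα : 1 / q = 1 / p - α) (hV0 : V ≠ 0) (hV : V ≠ ∞) (hAN : A ≤ N)
    (hAG : A ≤ G ^ (1 / p) * V ^ (-(1 / p))) : V ^ α * A ≤ G ^ α * N ^ (p / q) := by
  have hp0 : 0 < p := by linarith
  have hq0 : 0 < q := by linarith
  have hθ : 0 ≤ 1 - p / q := by
    rw [sub_nonneg, div_le_one hq0]
    exact hpq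
  have hexp : 1 / p * (1 - p / q) = α := by
    have : 1 / p * (1 - p / q) = 1 / p - 1 / q := by field_simp
    rw [this, hα]
    ring
  calc V ^ α * A = V ^ α * (A ^ (1 - p / q) * A ^ (p / q)) := by
        rw [← ENNReal.rpow_add_of_nonneg _ _ hθ (by positivity)]
        simp
    _ ≤ V ^ α * ((G ^ (1 / p) * V ^ (-(1 / p))) ^ (1 - p / q) * N ^ (p / q)) := by gcongr
    _ = V ^ α * (G ^ α * V ^ (-α) * N ^ (p / q)) := by
        rw [ENNReal.mul_rpow_of_nonneg _ _ hθ, ← ENNReal.rpow_mul, ← ENNReal.rpow_mul, neg_mul,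
          hexp]
    _ = V ^ α * V ^ (-α) * (G ^ α * N ^ (p / q)) := by ring
    _ = G ^ α * N ^ (p / q) := by
        rw [← ENNReal.rpow_add _ _ hV0 hV, add_neg_cancel, ENNReal.rpow_zero, one_mul]

theorem IsDoublingOnCubes.average_le {ν : Measure (Fin n → ℝ)} {D : ℝ≥0}
    (hν : IsDoublingOnCubes ν D) {p : ℝ} (hp : 1 < p) {g : (Fin n → ℝ) → ℝ≥0∞}
    (hg : Measurable g) (c : Fin n → ℝ) {r : ℝ} (hr : 0 < r) :
    (∫⁻ y in closedBall c r, g y ∂ν) / ν (closedBall c r) ≤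
      (∫⁻ y in closedBall c r, g y ^ p ∂ν) ^ (1 / p) * ν (closedBall c r) ^ (-(1 / p)) := by
  have h0 := hν.ne_zero c r hr
  have ht := hν.ne_top c r
  rw [ENNReal.div_le_iff h0 ht, mul_assoc]
  refine (setLIntegral_le_rpow_mul_measure_rpow ν hp hg.aemeasurable).trans_eq ?_
  congr 1
  nth_rewrite 3 [← ENNReal.rpow_one (ν (closedBall c r))]
  rw [← ENNReal.rpow_add _ _ h0 ht]
  congr 1
  ring

/-- Pointwise bound for the fractional maximal function on a cube `Q` of radius `r`: the cubes of
radius at most `r` lie in the triple of `Q`, and the larger ones have measure at least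
`D⁻¹ ν(Q)`. -/
theorem IsDoublingOnCubes.fractionalMaximal_le {ν : Measure (Fin n → ℝ)} {D : ℝ≥0}
    (hν : IsDoublingOnCubes ν D) {p q κ α : ℝ} (hp : 1 < p) (hpq : p ≤ q)
    (hα : 1 / q = 1 / p - α) (hκ : κ < p / q) {g : (Fin n → ℝ) → ℝ≥0∞} (hg : Measurable g)
    {B : ℝ≥0∞} (hB : ∀ (c : Fin n → ℝ) (r : ℝ), 0 < r →
      ∫⁻ y in closedBall c r, g y ^ p ∂ν ≤ B ^ p * ν (closedBall c r) ^ κ)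
    (c : Fin n → ℝ) {r : ℝ} (hr : 0 < r) {x : Fin n → ℝ} (hx : x ∈ closedBall c r) :
    fractionalMaximal ν α g x ≤
      (∫⁻ y in closedBall c (3 * r), g y ^ p ∂ν) ^ α *
        truncatedMaximal ν (2 * r) ((closedBall c (3 * r)).indicator g) x ^ (p / q) +
      B * D ^ (1 / q - κ / p) * ν (closedBall c r) ^ (-(1 / q - κ / p)) := by
  have hp0 : 0 < p := by linarith
  have hq0 : 0 < q := by linarith
  have he : 0 < 1 / q - κ / p := by
    rw [sub_pos, div_lt_div_iff₀ hp0 hq0, one_mul]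
    rwa [lt_div_iff₀ hq0] at hκ
  set e := 1 / q - κ / p with he_def
  rw [fractionalMaximal]
  refine iSup₂_le fun d s => iSup₂_le fun hs hxs => ?_
  have h0 := hν.ne_zero d s hs
  have ht := hν.ne_top d s
  have hA := hν.average_le hp hg d hs
  rcases le_total s r with hsr | hsr
  · refine le_trans ?_ le_self_add
    have hsub := closedBall_subset_triple hsr hx hxs
    refine rpow_mul_le_of_le_of_le hp hpq hα h0 ht ?_ (hA.trans ?_)
    · refine le_trans ?_ (le_truncatedMaximal ν _ hs (by linarith) hxs)
      gcongr 1
      exact (setLIntegral_congr_fun measurableSet_closedBall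
        fun y hy => (indicator_of_mem (hsub hy) g).symm).le
    · gcongr
  · refine le_trans ?_ le_add_self
    have hQ : ν (closedBall c r) ≤ D * ν (closedBall d s) := by
      refine (measure_mono ((closedBall_subset_triple hsr hxs hx).trans
        (closedBall_subset_closedBall ?_))).trans (hν.le_mul d s hs)
      linarith
    have hQ' : ν (closedBall d s) ^ (-e) ≤ D ^ e * ν (closedBall c r) ^ (-e) := by
      rw [ENNReal.rpow_neg, ENNReal.rpow_neg, ← div_eq_mul_inv, ENNReal.le_div_iff_mul_le
        (Or.inl (by simp [ENNReal.rpow_eq_zero_iff, hν.ne_zero c r hr, hν.ne_top c r]))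
        (Or.inl (ENNReal.rpow_ne_top_of_nonneg he.le (hν.ne_top c r)))]
      calc (ν (closedBall d s) ^ e)⁻¹ * ν (closedBall c r) ^ e
          ≤ (ν (closedBall d s) ^ e)⁻¹ * (D * ν (closedBall d s)) ^ e := by gcongr
        _ = D ^ e * ((ν (closedBall d s) ^ e)⁻¹ * ν (closedBall d s) ^ e) := by
          rw [ENNReal.mul_rpow_of_nonneg _ _ he.le]; ring
        _ ≤ D ^ e * 1 := by
          gcongr
          exact ENNReal.inv_mul_le_one _
        _ = D ^ e := mul_one _
    calc _ ≤ ν (closedBall d s) ^ α *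
          ((B ^ p * ν (closedBall d s) ^ κ) ^ (1 / p) * ν (closedBall d s) ^ (-(1 / p))) := by
          refine mul_le_mul_right (hA.trans ?_) _
          gcongr
          exact hB d s hs
      _ = B * (ν (closedBall d s) ^ α * ν (closedBall d s) ^ (κ / p) *
          ν (closedBall d s) ^ (-(1 / p))) := by
          rw [ENNReal.mul_rpow_of_nonneg _ _ (by positivity), ← ENNReal.rpow_mul,
            ← ENNReal.rpow_mul, mul_one_div_cancel hp0.ne', ENNReal.rpow_one, mul_one_div]
          ring
      _ = B * ν (closedBall d s) ^ (-e) := by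
          rw [← ENNReal.rpow_add _ _ h0 ht, ← ENNReal.rpow_add _ _ h0 ht]
          congr 2
          rw [he_def, hα]
          ring
      _ ≤ B * (D ^ e * ν (closedBall c r) ^ (-e)) := by gcongr
      _ = _ := by ring

/-- The fractional maximal function is bounded between Morrey spaces. For `α = 0` and `q = p`, this
is the boundedness of the Hardy-Littlewood maximal function on a Morrey space. -/
theorem IsDoublingOnCubes.exists_lintegral_fractionalMaximal_rpow_le {D : ℝ≥0} {p q κ α : ℝ}
    (hp : 1 < p) (hpq : p ≤ q) (hα : 1 / q = 1 / p - α) (hκ0 : 0 < κ) (hκ : κ < p / q) :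
    ∃ K : ℝ≥0, ∀ (ν : Measure (Fin n → ℝ)), IsDoublingOnCubes ν D →
      ∀ (g : (Fin n → ℝ) → ℝ≥0∞), Measurable g → ∀ B : ℝ≥0∞, B ≠ ∞ →
        (∀ (c : Fin n → ℝ) (r : ℝ), 0 < r →
          ∫⁻ y in closedBall c r, g y ^ p ∂ν ≤ B ^ p * ν (closedBall c r) ^ κ) →
        ∀ (c : Fin n → ℝ) (r : ℝ), 0 < r →
          ∫⁻ y in closedBall c r, fractionalMaximal ν α g y ^ q ∂ν ≤
            K * (B ^ q * ν (closedBall c r) ^ (κ * q / p)) := by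
  have hp0 : 0 < p := by linarith
  have hq0 : 0 < q := by linarith
  have hα0 : 0 ≤ α := by
    have : 1 / q ≤ 1 / p := one_div_le_one_div_of_le hp0 hpq
    linarith
  have he : 0 < 1 / q - κ / p := by
    rw [sub_pos, div_lt_div_iff₀ hp0 hq0, one_mul]
    rwa [lt_div_iff₀ hq0] at hκ
  obtain ⟨K₀, hK₀⟩ := exists_lintegral_truncatedMaximal_rpow_le (n := n) (D := D) hp
  set e := 1 / q - κ / p with he_def
  have hκq : 0 ≤ κ * q / p := by positivity
  refine ⟨(2 ^ (q - 1) * (K₀ * D ^ (κ * q / p) + (D ^ e) ^ q) : ℝ≥0∞).toNNReal,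
    fun ν hν g hg B hBtop hB c r hr => ?_⟩
  have hKtop : (2 ^ (q - 1) * (K₀ * D ^ (κ * q / p) + (D ^ e) ^ q) : ℝ≥0∞) ≠ ∞ := by
    have h1 : (D : ℝ≥0∞) ^ (κ * q / p) ≠ ∞ := ENNReal.rpow_ne_top_of_nonneg hκq (by simp)
    have h2 : (D : ℝ≥0∞) ^ e ≠ ∞ := ENNReal.rpow_ne_top_of_nonneg he.le (by simp)
    have h3 : (2 : ℝ≥0∞) ^ (q - 1) ≠ ∞ := ENNReal.rpow_ne_top_of_nonneg (by linarith) (by simp)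
    exact ENNReal.mul_ne_top h3 (ENNReal.add_ne_top.2 ⟨ENNReal.mul_ne_top (by simp) h1,
      ENNReal.rpow_ne_top_of_nonneg hq0.le h2⟩)
  rw [ENNReal.coe_toNNReal hKtop]
  set Q := closedBall c r with hQ
  set T := closedBall c (3 * r) with hT
  have hQ0 : ν Q ≠ 0 := hν.ne_zero c r hr
  have hQt : ν Q ≠ ∞ := hν.ne_top c r
  set G := ∫⁻ y in T, g y ^ p ∂ν with hG
  have hTQ : ν T ≤ D * ν Q := by
    refine (measure_mono (closedBall_subset_closedBall ?_)).trans (hν.le_mul c r hr)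
    linarith
  have hGB : G ≤ B ^ p * (D * ν Q) ^ κ := by
    refine (hB c (3 * r) (by positivity)).trans ?_
    gcongr
  have hGtop : G ≠ ∞ := by
    refine ne_top_of_le_ne_top (ENNReal.mul_ne_top ?_ ?_) hGB
    · exact ENNReal.rpow_ne_top_of_nonneg hp0.le hBtop
    · exact ENNReal.rpow_ne_top_of_nonneg hκ0.le (ENNReal.mul_ne_top (by simp) hQt)
  set N := truncatedMaximal ν (2 * r) (T.indicator g) with hN
  have hNmeas : Measurable N :=
    (lowerSemicontinuous_truncatedMaximal hν.ne_top _ _).measurable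
  have hNint : ∫⁻ x, N x ^ p ∂ν ≤ K₀ * G := by
    refine (hK₀ ν hν (2 * r) _ (hg.indicator measurableSet_closedBall) ?_).trans_eq ?_
    · rw [lintegral_indicator measurableSet_closedBall]
      refine ne_top_of_le_ne_top (ENNReal.mul_ne_top ?_ ?_)
        (setLIntegral_le_rpow_mul_measure_rpow ν hp hg.aemeasurable)
      · exact ENNReal.rpow_ne_top_of_nonneg (by positivity) hGtop
      · refine ENNReal.rpow_ne_top_of_nonneg ?_ (hν.ne_top _ _)
        rw [sub_nonneg, div_le_one hp0]
        exact hp.le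
    · rw [hG, ← lintegral_indicator measurableSet_closedBall]
      refine congrArg _ (lintegral_congr fun x => ?_)
      by_cases hx : x ∈ T
      · rw [indicator_of_mem hx, indicator_of_mem hx]
      · rw [indicator_of_notMem hx, indicator_of_notMem hx, ENNReal.zero_rpow_of_pos hp0]
  have hGq : G ^ (α * q) * G = G ^ (q / p) := by
    nth_rewrite 2 [← ENNReal.rpow_one G]
    rw [← ENNReal.rpow_add_of_nonneg _ _ (by positivity) zero_le_one]
    congr 1
    have : α = 1 / p - 1 / q := by linarith
    rw [this]
    field_simp
    ring
  have hGq' : G ^ (q / p) ≤ D ^ (κ * q / p) * (B ^ q * ν Q ^ (κ * q / p)) := by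
    calc G ^ (q / p) ≤ (B ^ p * (D * ν Q) ^ κ) ^ (q / p) := by gcongr
      _ = B ^ q * (D * ν Q) ^ (κ * q / p) := by
        rw [ENNReal.mul_rpow_of_nonneg _ _ (by positivity), ← ENNReal.rpow_mul,
          ← ENNReal.rpow_mul, mul_div_cancel₀ _ hp0.ne', mul_div_assoc]
      _ = _ := by
        rw [ENNReal.mul_rpow_of_nonneg _ _ hκq]
        ring
  have hfar : (B * D ^ e * ν Q ^ (-e)) ^ q * ν Q = (D ^ e) ^ q * (B ^ q * ν Q ^ (κ * q / p)) := by
    have h1 : ν Q ^ (-e * q) * ν Q = ν Q ^ (κ * q / p) := by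
      nth_rewrite 2 [← ENNReal.rpow_one (ν Q)]
      rw [← ENNReal.rpow_add _ _ hQ0 hQt]
      congr 1
      rw [he_def]
      field_simp
      ring
    rw [ENNReal.mul_rpow_of_nonneg _ _ hq0.le, ENNReal.mul_rpow_of_nonneg _ _ hq0.le,
      ← ENNReal.rpow_mul _ (-e), mul_assoc, h1]
    ring
  calc ∫⁻ y in Q, fractionalMaximal ν α g y ^ q ∂ν
      ≤ ∫⁻ y in Q, 2 ^ (q - 1) * (G ^ (α * q) * N y ^ p + (B * D ^ e * ν Q ^ (-e)) ^ q) ∂ν := by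
        refine setLIntegral_mono' measurableSet_closedBall fun y hy => ?_
        refine (ENNReal.rpow_le_rpow
          (hν.fractionalMaximal_le hp hpq hα hκ hg hB c hr hy) hq0.le).trans ?_
        refine (ENNReal.rpow_add_le_mul_rpow_add_rpow _ _ (by linarith)).trans_eq ?_
        rw [ENNReal.mul_rpow_of_nonneg _ _ hq0.le, ← ENNReal.rpow_mul, ← ENNReal.rpow_mul,
          div_mul_cancel₀ _ hq0.ne']
    _ = 2 ^ (q - 1) * (G ^ (α * q) * ∫⁻ y in Q, N y ^ p ∂ν +
          (B * D ^ e * ν Q ^ (-e)) ^ q * ν Q) := by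
        rw [lintegral_const_mul _ (by fun_prop), lintegral_add_right _ measurable_const,
          lintegral_const_mul _ (by fun_prop), setLIntegral_const]
    _ ≤ 2 ^ (q - 1) * (G ^ (α * q) * (K₀ * G) +
          (B * D ^ e * ν Q ^ (-e)) ^ q * ν Q) := by
        gcongr
        exact (setLIntegral_le_lintegral _ _).trans hNint
    _ = 2 ^ (q - 1) * (K₀ * G ^ (q / p) + (D ^ e) ^ q * (B ^ q * ν Q ^ (κ * q / p))) := by
        rw [hfar, ← hGq]
        ring
    _ ≤ 2 ^ (q - 1) * (K₀ * (D ^ (κ * q / p) * (B ^ q * ν Q ^ (κ * q / p))) +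
          (D ^ e) ^ q * (B ^ q * ν Q ^ (κ * q / p))) := by gcongr
    _ = _ := by ring

/-! ### Weights of class `A₁` -/

/-- The measure `μ(x) dx` of a weight `μ`. -/
noncomputable def weightedVolume (μ : (Fin n → ℝ) → ℝ) : Measure (Fin n → ℝ) :=
  volume.withDensity fun x => ENNReal.ofReal (μ x)

theorem IsCube.weightMeasure_eq (μ : (Fin n → ℝ) → ℝ) {Q : Set (Fin n → ℝ)} (hQ : IsCube Q) :
    weightMeasure μ Q = weightedVolume μ Q :=
  (withDensity_apply _ hQ.measurableSet).symm

theorem IsWeight.aemeasurable {μ : (Fin n → ℝ) → ℝ} (hμ : IsWeight μ) : AEMeasurable μ volume :=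
  hμ.locallyIntegrable.aestronglyMeasurable.aemeasurable

theorem IsWeight.setLIntegral_weightedVolume {μ : (Fin n → ℝ) → ℝ} (hμ : IsWeight μ)
    (g : (Fin n → ℝ) → ℝ≥0∞) {Q : Set (Fin n → ℝ)} (hQ : MeasurableSet Q) :
    ∫⁻ x in Q, g x ∂weightedVolume μ = ∫⁻ x in Q, ENNReal.ofReal (μ x) * g x :=
  setLIntegral_withDensity_eq_setLIntegral_mul_non_measurable₀ volume
    hμ.aemeasurable.ennreal_ofReal.restrict g hQ
    (Filter.Eventually.of_forall fun _ => ENNReal.ofReal_lt_top)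

theorem IsCube.setLIntegral_ofReal {f : (Fin n → ℝ) → ℝ} (hf : LocallyIntegrable f volume)
    (hf0 : ∀ x, 0 ≤ f x) {Q : Set (Fin n → ℝ)} (hQ : IsCube Q) :
    ∫⁻ y in Q, ENNReal.ofReal (f y) = ENNReal.ofReal (⨍ y in Q, f y) * volume Q := by
  have hint : Integrable f (volume.restrict Q) := hf.integrableOn_isCompact hQ.isCompact
  rw [← ofReal_integral_eq_lintegral_ofReal hint (Filter.Eventually.of_forall hf0),
    ← measure_smul_setAverage f hQ.volume_ne_top, smul_eq_mul,
    ENNReal.ofReal_mul measureReal_nonneg, mul_comm, Measure.real,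
    ENNReal.ofReal_toReal hQ.volume_ne_top]

theorem IsWeight.weightedVolume_eq_ofReal_average_mul {μ : (Fin n → ℝ) → ℝ} (hμ : IsWeight μ)
    {Q : Set (Fin n → ℝ)} (hQ : IsCube Q) :
    weightedVolume μ Q = ENNReal.ofReal (⨍ y in Q, μ y) * volume Q := by
  rw [weightedVolume, withDensity_apply _ hQ.measurableSet,
    hQ.setLIntegral_ofReal hμ.locallyIntegrable hμ.nonneg]

theorem IsWeight.weightedVolume_ne_top {μ : (Fin n → ℝ) → ℝ} (hμ : IsWeight μ)
    {Q : Set (Fin n → ℝ)} (hQ : IsCube Q) : weightedVolume μ Q ≠ ∞ := by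
  rw [hμ.weightedVolume_eq_ofReal_average_mul hQ]
  exact ENNReal.mul_ne_top ENNReal.ofReal_ne_top hQ.volume_ne_top

theorem IsWeight.absolutelyContinuous {μ : (Fin n → ℝ) → ℝ} (hμ : IsWeight μ) :
    (volume : Measure (Fin n → ℝ)) ≪ weightedVolume μ :=
  withDensity_absolutelyContinuous' hμ.aemeasurable.ennreal_ofReal
    (hμ.ae_pos.mono fun x hx => by simpa using hx)

theorem IsWeight.weightedVolume_ne_zero {μ : (Fin n → ℝ) → ℝ} (hμ : IsWeight μ)
    {Q : Set (Fin n → ℝ)} (hQ : IsCube Q) : weightedVolume μ Q ≠ 0 := fun h =>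
  hQ.volume_ne_zero (hμ.absolutelyContinuous h)

/-- The `A₁` condition for the measure `μ(x) dx`: the least density on a cube `Q` is comparable to
`μ(Q) / |Q|`, for every subcube of `Q` and, in the limit, for almost every point of `Q`, with an
exceptional set independent of `Q`. -/
structure A1Bound (μ : (Fin n → ℝ) → ℝ) (C : ℝ≥0) : Prop where
  mul_volume_le : ∀ P Q : Set (Fin n → ℝ), IsCube P → IsCube Q → P ⊆ Q →
    weightedVolume μ Q * volume P ≤ C * weightedVolume μ P * volume Q
  ae_le : ∀ᵐ x, ∀ Q : Set (Fin n → ℝ), IsCube Q → x ∈ Q →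
    weightedVolume μ Q ≤ C * ENNReal.ofReal (μ x) * volume Q

theorem IsA1.exists_a1Bound {μ : (Fin n → ℝ) → ℝ} (hμ : IsA1 μ) : ∃ C : ℝ≥0, A1Bound μ C := by
  obtain ⟨C, hC, h⟩ := hμ.exists_const
  have hw := hμ.isWeight
  have hsub : ∀ P Q : Set (Fin n → ℝ), IsCube P → IsCube Q → P ⊆ Q →
      weightedVolume μ Q * volume P ≤ C.toNNReal * weightedVolume μ P * volume Q := by
    intro P Q hP hQ hPQ
    have h1 : ∀ᵐ x ∂(volume.restrict P),
        weightedVolume μ Q ≤ C.toNNReal * volume Q * ENNReal.ofReal (μ x) := by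
      filter_upwards [ae_restrict_of_ae_restrict_of_subset hPQ (h Q hQ)] with x hx
      rw [hw.weightedVolume_eq_ofReal_average_mul hQ, mul_right_comm]
      gcongr
      refine (ENNReal.ofReal_le_ofReal hx).trans_eq ?_
      rw [ENNReal.ofReal_mul hC.le]
      rfl
    calc weightedVolume μ Q * volume P = ∫⁻ _ in P, weightedVolume μ Q := by
          rw [setLIntegral_const]
      _ ≤ ∫⁻ x in P, C.toNNReal * volume Q * ENNReal.ofReal (μ x) := lintegral_mono_ae h1
      _ = C.toNNReal * volume Q * weightedVolume μ P := by
          rw [lintegral_const_mul' _ _ (ENNReal.mul_ne_top (by simp) hQ.volume_ne_top),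
            weightedVolume, withDensity_apply _ hP.measurableSet]
      _ = _ := by ring
  refine ⟨C.toNNReal, hsub, ?_⟩
  filter_upwards [ae_tendsto_average_shrunkCube hw.locallyIntegrable] with x hx Q hQ hxQ
  obtain ⟨c, r, hr, rfl⟩ := hQ
  have hQ := isCube_closedBall c hr
  have hlim := ENNReal.Tendsto.const_mul (a := C.toNNReal * volume (closedBall c r))
    ((ENNReal.continuous_ofReal.tendsto _).comp (hx c r hr hxQ))
    (Or.inr (ENNReal.mul_ne_top (by simp) hQ.volume_ne_top))
  rw [mul_right_comm]
  refine ge_of_tendsto' hlim fun k => ?_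
  have hP := isCube_shrunkCube c x hr k
  have h1 := hsub _ _ hP hQ (shrunkCube_subset hxQ k)
  rw [hw.weightedVolume_eq_ofReal_average_mul hP, ← mul_assoc, mul_right_comm,
    ENNReal.mul_le_mul_iff_left hP.volume_ne_zero hP.volume_ne_top] at h1
  rwa [mul_right_comm] at h1

theorem A1Bound.isDoublingOnCubes {μ : (Fin n → ℝ) → ℝ} {C : ℝ≥0} (h : A1Bound μ C)
    (hμ : IsWeight μ) : IsDoublingOnCubes (weightedVolume μ) (C * 5 ^ n) where
  ne_zero c r hr := hμ.weightedVolume_ne_zero (isCube_closedBall c hr)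
  ne_top c r := ne_top_of_le_ne_top
    (hμ.weightedVolume_ne_top (isCube_closedBall c (r := max r 1) (by positivity)))
    (measure_mono (closedBall_subset_closedBall (le_max_left r 1)))
  le_mul c r hr := by
    have hP := isCube_closedBall c hr
    have h1 := h.mul_volume_le _ _ hP (isCube_closedBall c (r := 5 * r) (by positivity))
      (closedBall_subset_closedBall (by linarith))
    rw [volume_closedBall_mul c c hr.le (by norm_num), ← mul_assoc,
      ENNReal.mul_le_mul_iff_left hP.volume_ne_zero hP.volume_ne_top] at h1
    refine h1.trans_eq ?_
    rw [ENNReal.ofReal_pow (by norm_num)]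
    push_cast
    simp only [ENNReal.ofReal_ofNat]
    ring

/-- **Reverse doubling**: by the `A₁` condition, the subcube that a quarter-size subcube leaves
free carries a fixed proportion of the measure. -/
theorem A1Bound.exists_reverse_doubling (hn : 0 < n) {μ : (Fin n → ℝ) → ℝ} {C : ℝ≥0}
    (h : A1Bound μ C) (hμ : IsWeight μ) : ∃ η : ℝ≥0∞, η < 1 ∧
      ∀ (c d : Fin n → ℝ) (r : ℝ), 0 < r → closedBall d (r / 4) ⊆ closedBall c r →
        weightedVolume μ (closedBall d (r / 4)) ≤ η * weightedVolume μ (closedBall c r) := by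
  refine ⟨1 - (C * ENNReal.ofReal (4 ^ n))⁻¹, ENNReal.sub_lt_self ENNReal.one_ne_top one_ne_zero
    (ENNReal.inv_ne_zero.2 (ENNReal.mul_ne_top (by simp) ENNReal.ofReal_ne_top)),
    fun c d r hr hd => ?_⟩
  obtain ⟨e, he, hdisj⟩ := exists_closedBall_quarter_disjoint ⟨0, hn⟩ c d hr
  have hP := isCube_closedBall e (r := r / 4) (by positivity)
  have hQ := isCube_closedBall c hr
  have h1 := h.mul_volume_le _ _ hP hQ he
  have h2 : volume (closedBall c r) = ENNReal.ofReal (4 ^ n) * volume (closedBall e (r / 4)) := by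
    rw [← volume_closedBall_mul c e (by positivity) (by norm_num)]
    congr 2
    ring
  rw [h2, ← mul_assoc, ENNReal.mul_le_mul_iff_left hP.volume_ne_zero hP.volume_ne_top,
    mul_right_comm, mul_comm] at h1
  have h3 : (C * ENNReal.ofReal (4 ^ n))⁻¹ * weightedVolume μ (closedBall c r) ≤
      weightedVolume μ (closedBall e (r / 4)) := by
    rw [mul_comm, ← div_eq_mul_inv]
    exact ENNReal.div_le_of_le_mul h1
  rw [ENNReal.sub_mul (fun _ _ => hμ.weightedVolume_ne_top hQ), one_mul]
  refine le_trans ?_ (tsub_le_tsub_left h3 _)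
  refine ENNReal.le_sub_of_add_le_right (hμ.weightedVolume_ne_top hP) ?_
  rw [← measure_union hdisj.symm hP.measurableSet]
  exact measure_mono (union_subset hd he)

theorem weightedVolume_shrunkCube_le {μ : (Fin n → ℝ) → ℝ} {η : ℝ≥0∞}
    (hη : ∀ (c d : Fin n → ℝ) (r : ℝ), 0 < r → closedBall d (r / 4) ⊆ closedBall c r →
      weightedVolume μ (closedBall d (r / 4)) ≤ η * weightedVolume μ (closedBall c r))
    {c x : Fin n → ℝ} {r : ℝ} (hr : 0 < r) (hx : x ∈ closedBall c r) (k : ℕ) :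
    weightedVolume μ (shrunkCube c x r k) ≤ η ^ k * weightedVolume μ (closedBall c r) := by
  induction k with
  | zero => simp [shrunkCube_zero]
  | succ k ih =>
    have hsub := shrunkCube_succ_subset hx k
    have hrad : (1 / 4 : ℝ) ^ (k + 1) * r = (1 / 4 : ℝ) ^ k * r / 4 := by
      rw [pow_succ]; ring
    unfold shrunkCube at hsub ih ⊢
    rw [hrad] at hsub ⊢
    refine (hη _ _ _ (by positivity) hsub).trans ?_
    rw [pow_succ', mul_assoc]
    gcongr

/-! ### Weighted Lipschitz functions -/

theorem IsCube.enorm_setAverage_sub_le {f : (Fin n → ℝ) → ℝ} (hf : LocallyIntegrable f volume)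
    {Q : Set (Fin n → ℝ)} (hQ : IsCube Q) (a : ℝ) :
    ‖(⨍ y in Q, f y) - a‖ₑ ≤ (∫⁻ y in Q, ‖f y - a‖ₑ) / volume Q := by
  have hne : NeZero (volume.restrict Q) := ⟨by simpa using hQ.volume_ne_zero⟩
  have hfin : IsFiniteMeasure (volume.restrict Q) := ⟨by simpa using hQ.volume_ne_top.lt_top⟩
  have hint : Integrable f (volume.restrict Q) :=
    hf.integrableOn_isCompact hQ.isCompact
  have h1 : (⨍ y in Q, f y) - a = ⨍ y in Q, (f y - a) := by
    nth_rewrite 1 [← average_const (volume.restrict Q) a]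
    rw [average, average, average, integral_sub]
    · exact hint.to_average
    · exact integrable_const _
  rw [h1, average]
  refine (enorm_integral_le_lintegral_enorm _).trans_eq ?_
  rw [lintegral_smul_measure, Measure.restrict_apply_univ, smul_eq_mul, mul_comm, div_eq_mul_inv]

/-- A weighted Lipschitz function differs from its average over a cube `Q ∋ x` by at most a
multiple of `μ(x) μ(Q)^γ`: sum the differences of its averages over cubes that shrink to `x`; by
reverse doubling they decay geometrically. -/
theorem A1Bound.exists_enorm_sub_setAverage_le (hn : 0 < n) {μ : (Fin n → ℝ) → ℝ} {C : ℝ≥0}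
    (h : A1Bound μ C) (hμ : IsWeight μ) {γ : ℝ} (hγ : 0 < γ) : ∃ K : ℝ≥0,
      ∀ (b : (Fin n → ℝ) → ℝ), LocallyIntegrable b volume → ∀ L : ℝ≥0∞,
        (∀ Q : Set (Fin n → ℝ), IsCube Q →
          ∫⁻ y in Q, ‖b y - ⨍ z in Q, b z‖ₑ ≤ L * weightedVolume μ Q ^ (1 + γ)) →
        ∀ᵐ x, ∀ Q : Set (Fin n → ℝ), IsCube Q → x ∈ Q →
          ‖b x - ⨍ z in Q, b z‖ₑ ≤
            K * L * ENNReal.ofReal (μ x) * weightedVolume μ Q ^ γ := by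
  obtain ⟨η, hη, hrev⟩ := h.exists_reverse_doubling hn hμ
  have hηγ : η ^ γ < 1 := ENNReal.rpow_lt_one hη hγ
  refine ⟨(C * ENNReal.ofReal (4 ^ n) * (1 - η ^ γ)⁻¹).toNNReal, fun b hb L hL => ?_⟩
  rw [ENNReal.coe_toNNReal (ENNReal.mul_ne_top (ENNReal.mul_ne_top (by simp) ENNReal.ofReal_ne_top)
    (ENNReal.inv_ne_top.2 (tsub_pos_of_lt hηγ).ne'))]
  filter_upwards [ae_tendsto_average_shrunkCube hb, h.ae_le] with x hx hA Q hQ hxQ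
  obtain ⟨c, r, hr, rfl⟩ := hQ
  set S := shrunkCube c x r with hS
  have hScube : ∀ k, IsCube (S k) := isCube_shrunkCube c x hr
  have hdecay := weightedVolume_shrunkCube_le hrev hr hxQ
  have hstep : ∀ k, edist (⨍ y in S k, b y) (⨍ y in S (k + 1), b y) ≤
      C * ENNReal.ofReal (4 ^ n) * L * ENNReal.ofReal (μ x) *
        weightedVolume μ (closedBall c r) ^ γ * (η ^ γ) ^ k := by
    intro k
    rw [edist_comm, edist_eq_enorm_sub]
    have hvol := volume_shrunkCube_succ c x hr k
    have hV0 := (hScube (k + 1)).volume_ne_zero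
    have hVt := (hScube (k + 1)).volume_ne_top
    refine ((hScube (k + 1)).enorm_setAverage_sub_le hb _).trans ?_
    rw [ENNReal.div_le_iff hV0 hVt]
    calc ∫⁻ y in S (k + 1), ‖b y - ⨍ y in S k, b y‖ₑ
        ≤ ∫⁻ y in S k, ‖b y - ⨍ y in S k, b y‖ₑ :=
          lintegral_mono_set (shrunkCube_succ_subset hxQ k)
      _ ≤ L * weightedVolume μ (S k) ^ (1 + γ) := hL _ (hScube k)
      _ = L * (weightedVolume μ (S k) * weightedVolume μ (S k) ^ γ) := by
          rw [ENNReal.rpow_add_of_nonneg _ _ zero_le_one hγ.le, ENNReal.rpow_one]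
      _ ≤ L * ((C * ENNReal.ofReal (μ x) * volume (S k)) *
            (η ^ k * weightedVolume μ (closedBall c r)) ^ γ) := by
          gcongr
          · exact hA _ (hScube k) (mem_shrunkCube hxQ k)
          · exact hdecay k
      _ = _ := by
          rw [hvol, ENNReal.mul_rpow_of_nonneg _ _ hγ.le, ← ENNReal.rpow_natCast_mul,
            mul_comm (k : ℝ) γ, ENNReal.rpow_mul_natCast]
          ring
  have hsum := edist_le_tsum_of_edist_le_of_tendsto₀ _ hstep (hx c r hr hxQ)
  rw [ENNReal.tsum_mul_left, ENNReal.tsum_geometric, hS, shrunkCube_zero, edist_comm,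
    edist_eq_enorm_sub] at hsum
  refine hsum.trans_eq ?_
  ring

theorem A1Bound.weightedVolume_mul_setLIntegral_le {μ : (Fin n → ℝ) → ℝ} {C : ℝ≥0}
    (h : A1Bound μ C) (hμ : IsWeight μ) (g : (Fin n → ℝ) → ℝ≥0∞) {Q : Set (Fin n → ℝ)}
    (hQ : IsCube Q) :
    weightedVolume μ Q * ∫⁻ y in Q, g y ≤ C * volume Q * ∫⁻ y in Q, g y ∂weightedVolume μ := by
  rw [hμ.setLIntegral_weightedVolume g hQ.measurableSet,
    ← lintegral_const_mul' _ _ (hμ.weightedVolume_ne_top hQ),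
    ← lintegral_const_mul' _ _ (ENNReal.mul_ne_top (by simp) hQ.volume_ne_top)]
  refine lintegral_mono_ae ?_
  filter_upwards [ae_restrict_of_ae h.ae_le, ae_restrict_mem hQ.measurableSet] with y hy hyQ
  calc weightedVolume μ Q * g y ≤ C * ENNReal.ofReal (μ y) * volume Q * g y := by
        gcongr
        exact hy Q hQ hyQ
    _ = _ := by ring

/-- The averages of `|b(x) - b| g` over cubes containing `x` are controlled by the fractional
maximal function with respect to `μ(x) dx`. -/
theorem A1Bound.exists_setLIntegral_enorm_sub_mul_le (hn : 0 < n) {μ : (Fin n → ℝ) → ℝ} {C : ℝ≥0}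
    (h : A1Bound μ C) (hμ : IsWeight μ) {γ : ℝ} (hγ : 0 < γ) : ∃ K : ℝ≥0,
      ∀ (b : (Fin n → ℝ) → ℝ), LocallyIntegrable b volume → ∀ L : ℝ≥0∞, L ≠ ∞ →
        (∀ Q : Set (Fin n → ℝ), IsCube Q →
          ∫⁻ y in Q, ‖b y - ⨍ z in Q, b z‖ₑ ≤ L * weightedVolume μ Q ^ (1 + γ)) →
        ∀ᵐ x, ∀ Q : Set (Fin n → ℝ), IsCube Q → x ∈ Q → ∀ g : (Fin n → ℝ) → ℝ≥0∞, Measurable g →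
          ∫⁻ y in Q, ‖b x - b y‖ₑ * g y ≤
            K * L * ENNReal.ofReal (μ x) * fractionalMaximal (weightedVolume μ) γ g x *
              volume Q := by
  obtain ⟨K, hK⟩ := h.exists_enorm_sub_setAverage_le hn hμ hγ
  refine ⟨2 * K * C, fun b hb L hLtop hL => ?_⟩
  have hbK := hK b hb L hL
  filter_upwards [hbK, h.ae_le] with x hx hA Q hQ hxQ g hg
  have hν0 := hμ.weightedVolume_ne_zero hQ
  have hνt := hμ.weightedVolume_ne_top hQ
  set ν := weightedVolume μ with hν
  have hc : (K : ℝ≥0∞) * L * ν Q ^ γ ≠ ∞ :=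
    ENNReal.mul_ne_top (ENNReal.mul_ne_top (by simp) hLtop)
      (ENNReal.rpow_ne_top_of_nonneg hγ.le hνt)
  have hwmeas : AEMeasurable (fun y => ENNReal.ofReal (μ y) * g y) (volume.restrict Q) :=
    hμ.aemeasurable.ennreal_ofReal.restrict.mul hg.aemeasurable
  have havg : ∫⁻ y in Q, g y ≤ C * volume Q * ((∫⁻ y in Q, g y ∂ν) / ν Q) := by
    rw [← mul_div_assoc, ENNReal.le_div_iff_mul_le (Or.inl hν0) (Or.inl hνt), mul_comm]
    exact h.weightedVolume_mul_setLIntegral_le hμ g hQ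
  have hfrac : ν Q ^ γ * ((∫⁻ y in Q, g y ∂ν) / ν Q) ≤ fractionalMaximal ν γ g x := by
    obtain ⟨c, r, hr, rfl⟩ := hQ
    exact le_fractionalMaximal ν γ g hr hxQ
  calc ∫⁻ y in Q, ‖b x - b y‖ₑ * g y
      ≤ ∫⁻ y in Q, K * L * ν Q ^ γ *
          (ENNReal.ofReal (μ x) * g y + ENNReal.ofReal (μ y) * g y) := by
        refine lintegral_mono_ae ?_
        filter_upwards [ae_restrict_of_ae hbK, ae_restrict_mem hQ.measurableSet] with y hy hyQ
        have h1 : ‖b x - b y‖ₑ ≤ ‖b x - ⨍ z in Q, b z‖ₑ + ‖b y - ⨍ z in Q, b z‖ₑ := by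
          rw [← sub_sub_sub_cancel_right (b x) (b y) (⨍ z in Q, b z)]
          exact enorm_sub_le
        calc ‖b x - b y‖ₑ * g y ≤ (K * L * ENNReal.ofReal (μ x) * ν Q ^ γ +
              K * L * ENNReal.ofReal (μ y) * ν Q ^ γ) * g y := by
              gcongr
              exact h1.trans (add_le_add (hx Q hQ hxQ) (hy Q hQ hyQ))
          _ = _ := by ring
    _ = K * L * ν Q ^ γ * (ENNReal.ofReal (μ x) * ∫⁻ y in Q, g y) +
          K * L * ν Q ^ γ * (∫⁻ y in Q, g y ∂ν) := by
        rw [lintegral_const_mul' _ _ hc, lintegral_add_left (by fun_prop),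
          lintegral_const_mul _ hg, hμ.setLIntegral_weightedVolume g hQ.measurableSet, mul_add]
    _ ≤ K * L * ν Q ^ γ * (ENNReal.ofReal (μ x) *
          (C * volume Q * ((∫⁻ y in Q, g y ∂ν) / ν Q))) +
          K * L * ν Q ^ γ * (C * ENNReal.ofReal (μ x) * volume Q *
            ((∫⁻ y in Q, g y ∂ν) / ν Q)) := by
        gcongr
        calc ∫⁻ y in Q, g y ∂ν = ν Q * ((∫⁻ y in Q, g y ∂ν) / ν Q) :=
              (ENNReal.mul_div_cancel hν0 hνt).symm
          _ ≤ _ := by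
              gcongr
              exact hA Q hQ hxQ
    _ = 2 * K * C * L * ENNReal.ofReal (μ x) *
          (ν Q ^ γ * ((∫⁻ y in Q, g y ∂ν) / ν Q)) * volume Q := by ring
    _ ≤ _ := by
        push_cast
        gcongr

/-! ### The maximal functions and the norms -/

theorem maximalFunction_le_iff {f : (Fin n → ℝ) → ℝ} {x : Fin n → ℝ} {B : ℝ≥0∞} :
    maximalFunction f x ≤ B ↔ ∀ Q : Set (Fin n → ℝ), IsCube Q → x ∈ Q →
      (∫⁻ y in Q, ‖f y‖ₑ) / volume Q ≤ B := by
  simp only [maximalFunction, iSup_le_iff]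

theorem IsCube.le_maximalFunction {Q : Set (Fin n → ℝ)} (hQ : IsCube Q) (f : (Fin n → ℝ) → ℝ)
    {x : Fin n → ℝ} (hx : x ∈ Q) : (∫⁻ y in Q, ‖f y‖ₑ) / volume Q ≤ maximalFunction f x :=
  maximalFunction_le_iff.1 le_rfl Q hQ hx

theorem localMaximalFunction_le_iff {f : (Fin n → ℝ) → ℝ} {Q₀ : Set (Fin n → ℝ)}
    {x : Fin n → ℝ} {B : ℝ≥0∞} :
    localMaximalFunction Q₀ f x ≤ B ↔ ∀ Q : Set (Fin n → ℝ), IsCube Q → Q ⊆ Q₀ → x ∈ Q →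
      (∫⁻ y in Q, ‖f y‖ₑ) / volume Q ≤ B := by
  simp only [localMaximalFunction, iSup_le_iff]

theorem measurable_maximalFunction (f : (Fin n → ℝ) → ℝ) : Measurable (maximalFunction f) := by
  have h : maximalFunction f = fun x => ⨆ k : ℕ, truncatedMaximal volume k (fun y => ‖f y‖ₑ) x := by
    ext x
    apply le_antisymm
    · refine maximalFunction_le_iff.2 fun Q hQ hx => ?_
      obtain ⟨c, r, hr, rfl⟩ := hQ
      obtain ⟨k, hk⟩ := exists_nat_gt r
      exact le_iSup_of_le k (le_truncatedMaximal volume _ hr hk hx)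
    · refine iSup_le fun k => iSup₂_le fun c r => iSup₂_le fun hr _ => iSup_le fun hx => ?_
      exact (isCube_closedBall c hr).le_maximalFunction f hx
  rw [h]
  exact Measurable.iSup fun k => (lowerSemicontinuous_truncatedMaximal
    (fun c r => (isCompact_closedBall c r).measure_lt_top.ne) _ _).measurable

/-- On a cube `Q`, the maximal function of `b` localized to `Q` is the maximal function of
`b χ_Q`. -/
theorem IsCube.maximalFunction_mul_indicator {Q : Set (Fin n → ℝ)} (hQ : IsCube Q)
    (b : (Fin n → ℝ) → ℝ) {x : Fin n → ℝ} (hx : x ∈ Q) :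
    maximalFunction (fun y => b y * Q.indicator (fun _ => (1 : ℝ)) y) x =
      localMaximalFunction Q b x := by
  have hind : ∀ y, ‖b y * Q.indicator (fun _ => (1 : ℝ)) y‖ₑ =
      Q.indicator (fun y => ‖b y‖ₑ) y := by
    intro y
    by_cases hy : y ∈ Q
    · simp [hy]
    · simp [hy]
  apply le_antisymm
  · refine maximalFunction_le_iff.2 fun R hR hxR => ?_
    obtain ⟨P, hP, hPQ, hRP, hvol⟩ := exists_isCube_subset_of_inter hQ hR
    refine le_trans ?_
      (localMaximalFunction_le_iff.1 (le_refl (localMaximalFunction Q b x)) P hP hPQ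
        (hRP ⟨hxR, hx⟩))
    refine ENNReal.div_le_div ?_ hvol
    simp_rw [hind]
    rw [lintegral_indicator hQ.measurableSet, Measure.restrict_restrict hQ.measurableSet,
      inter_comm]
    exact lintegral_mono_set hRP
  · refine localMaximalFunction_le_iff.2 fun R hR hRQ hxR => ?_
    refine le_trans ?_ (hR.le_maximalFunction _ hxR)
    gcongr 1
    refine (setLIntegral_congr_fun hR.measurableSet fun y hy => ?_).le
    simp [indicator_of_mem (hRQ hy)]

theorem IsCube.maximalFunction_indicator {Q : Set (Fin n → ℝ)} (hQ : IsCube Q)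
    {x : Fin n → ℝ} (hx : x ∈ Q) : maximalFunction (Q.indicator (fun _ => (1 : ℝ))) x = 1 := by
  apply le_antisymm
  · refine maximalFunction_le_iff.2 fun R hR hxR => ENNReal.div_le_of_le_mul ?_
    calc ∫⁻ y in R, ‖Q.indicator (fun _ => (1 : ℝ)) y‖ₑ ≤ ∫⁻ y in R, 1 := by
          refine lintegral_mono fun y => ?_
          by_cases hy : y ∈ Q
          · simp [hy]
          · simp [hy]
      _ = 1 * volume R := by simp
  · refine le_trans ?_ (hQ.le_maximalFunction _ hx)
    rw [setLIntegral_congr_fun (g := fun _ => 1) hQ.measurableSet fun y hy => by simp [hy],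
      setLIntegral_const, one_mul, ENNReal.div_self hQ.volume_ne_zero hQ.volume_ne_top]

/-- On a cube `Q`, the commutator applied to `χ_Q` is `b - M_Q(b)`. -/
theorem IsCube.maximalCommutator_indicator {Q : Set (Fin n → ℝ)} (hQ : IsCube Q)
    (b : (Fin n → ℝ) → ℝ) {x : Fin n → ℝ} (hx : x ∈ Q) :
    maximalCommutator b (Q.indicator (fun _ => (1 : ℝ))) x =
      (b x : EReal) - (localMaximalFunction Q b x : EReal) := by
  rw [maximalCommutator, hQ.maximalFunction_indicator hx, hQ.maximalFunction_mul_indicator b hx]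
  simp

theorem aemeasurable_maximalCommutator {b : (Fin n → ℝ) → ℝ} (hb : AEMeasurable b volume)
    (f : (Fin n → ℝ) → ℝ) : AEMeasurable (maximalCommutator b f) volume := by
  unfold maximalCommutator
  simp only [sub_eq_add_neg]
  exact (hb.coe_real_ereal.mul (measurable_maximalFunction f).coe_ereal_ennreal.aemeasurable).add
    (continuous_neg.measurable.comp
      (measurable_maximalFunction _).coe_ereal_ennreal).aemeasurable

theorem ereal_abs_coe (t : ℝ) : (t : EReal).abs = ‖t‖ₑ := by
  rw [EReal.abs_def, ← Real.norm_eq_abs, ofReal_norm]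

/-- A number `a ≤ m` lies between `t` and `m` whenever `t ≤ a`. For `m = ∞` the right-hand side is
infinite. -/
theorem ofReal_sub_le_abs_sub {t a : ℝ} {m : ℝ≥0∞} (h : ENNReal.ofReal a ≤ m) :
    ENNReal.ofReal (a - t) ≤ ((t : EReal) - (m : EReal)).abs := by
  induction m with
  | top => simp
  | coe m =>
    have hm : ((m : ℝ≥0∞) : EReal) = ((m : ℝ) : EReal) := rfl
    have ha : a ≤ m := by
      rwa [← ENNReal.ofReal_coe_nnreal, ENNReal.ofReal_le_ofReal_iff (NNReal.coe_nonneg m)] at h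
    rw [hm, ← EReal.coe_sub, EReal.abs_def, abs_sub_comm]
    exact ENNReal.ofReal_le_ofReal ((sub_le_sub_right ha t).trans (le_abs_self _))

/-- For finite `A`, a two-sided bound in `[0, ∞]` gives a bound for the difference in `[-∞, ∞]`. The
case `A = B = ∞` has to be excluded, since there the difference is `-∞`. -/
theorem abs_coe_mul_sub_le {t : ℝ} (ht : 0 ≤ t) {A B U : ℝ≥0∞} (hA : A ≠ ∞)
    (h1 : B ≤ ‖t‖ₑ * A + U) (h2 : ‖t‖ₑ * A ≤ B + U) :
    ((t : EReal) * (A : EReal) - (B : EReal)).abs ≤ U := by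
  induction U with
  | top => simp
  | coe U =>
    have hB : B ≠ ∞ := ne_top_of_le_ne_top (by finiteness) h1
    lift A to ℝ≥0 using hA
    lift B to ℝ≥0 using hB
    lift t to ℝ≥0 using ht
    rw [Real.enorm_of_nonneg (NNReal.coe_nonneg t), ENNReal.ofReal_coe_nnreal] at h1 h2
    norm_cast at h1 h2
    have hc : ∀ m : ℝ≥0, ((m : ℝ≥0∞) : EReal) = ((m : ℝ) : EReal) := fun _ => rfl
    rw [hc, hc, ← EReal.coe_mul, ← EReal.coe_sub, EReal.abs_def, ← ENNReal.ofReal_coe_nnreal]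
    refine ENNReal.ofReal_le_ofReal (abs_sub_le_iff.2 ⟨?_, ?_⟩)
    · have : (t : ℝ) * A ≤ B + U := mod_cast h2
      linarith
    · have : (B : ℝ) ≤ t * A + U := mod_cast h1
      linarith

theorem morreyNorm_le_iff {μ : (Fin n → ℝ) → ℝ} (hμ : IsWeight μ) {p κ : ℝ} (hp : 0 < p)
    (u : (Fin n → ℝ) → ℝ) (g : (Fin n → ℝ) → EReal) {B : ℝ≥0∞} :
    morreyNorm p κ u μ g ≤ B ↔ ∀ Q : Set (Fin n → ℝ), IsCube Q →
      ∫⁻ x in Q, (g x).abs ^ p * ENNReal.ofReal (u x) ≤ B ^ p * weightedVolume μ Q ^ κ := by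
  simp only [morreyNorm, iSup_le_iff]
  refine forall₂_congr fun Q hQ => ?_
  have h0 := hμ.weightedVolume_ne_zero hQ
  have ht := hμ.weightedVolume_ne_top hQ
  rw [hQ.weightMeasure_eq, one_div, ENNReal.rpow_inv_le_iff hp, ENNReal.div_le_iff]
  · simp [ENNReal.rpow_eq_zero_iff, h0, ht]
  · simp [ENNReal.rpow_eq_top_iff, h0, ht]

theorem normalizedSize_le_iff {μ : (Fin n → ℝ) → ℝ} (hμ : IsWeight μ) {β s : ℝ} (hs : 0 < s)
    {Q : Set (Fin n → ℝ)} (hQ : IsCube Q) (g : (Fin n → ℝ) → EReal) {L : ℝ≥0∞} :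
    normalizedSize β s μ Q g ≤ L ↔
      (∫⁻ x in Q, (g x).abs ^ s * ENNReal.ofReal (μ x ^ (1 - s))) ^ (1 / s) ≤
        L * weightedVolume μ Q ^ (β / n + 1 / s) := by
  have h0 := hμ.weightedVolume_ne_zero hQ
  have ht := hμ.weightedVolume_ne_top hQ
  have h0' : ∀ a : ℝ, weightedVolume μ Q ^ a ≠ 0 := fun a => by
    simp [ENNReal.rpow_eq_zero_iff, h0, ht]
  have ht' : ∀ a : ℝ, weightedVolume μ Q ^ a ≠ ∞ := fun a => by
    simp [ENNReal.rpow_eq_top_iff, h0, ht]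
  rw [normalizedSize, hQ.weightMeasure_eq, ENNReal.div_rpow_of_nonneg _ _ (by positivity),
    ENNReal.div_le_iff (h0' _) (ht' _), ENNReal.div_le_iff (h0' _) (ht' _),
    ENNReal.rpow_add _ _ h0 ht, mul_assoc]

theorem normalizedSize_one_sub_le_iff {μ : (Fin n → ℝ) → ℝ} (hμ : IsWeight μ) {β : ℝ}
    {Q : Set (Fin n → ℝ)} (hQ : IsCube Q) (f : (Fin n → ℝ) → ℝ) {L : ℝ≥0∞} :
    normalizedSize β 1 μ Q (fun x => (f x : EReal)) ≤ L ↔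
      ∫⁻ x in Q, ‖f x‖ₑ ≤ L * weightedVolume μ Q ^ (1 + β / n) := by
  rw [normalizedSize_le_iff hμ one_pos hQ]
  simp [ereal_abs_coe, add_comm]

/-! ### From the commutator to the oscillation `b - M_Q(b)` -/

/-- Testing the commutator on the characteristic functions of cubes. -/
theorem exists_normalizedSize_le_of_boundedOnMorrey {b μ : (Fin n → ℝ) → ℝ} {β p q κ : ℝ}
    (hμ : IsWeight μ) (hp : 0 < p) (hq0 : 0 < q) (hq : 1 / q = 1 / p - β / n) (hκ0 : 0 < κ)
    (hκ1 : κ < 1) (h : BoundedOnMorrey (maximalCommutator b) p κ μ μ q (κ * q / p)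
      (fun x => μ x ^ (1 - q)) μ) :
    ∃ C : ℝ≥0, 0 < C ∧ ∀ Q : Set (Fin n → ℝ), IsCube Q → normalizedSize β q μ Q
      (fun x => (b x : EReal) - (localMaximalFunction Q b x : EReal)) ≤ C := by
  obtain ⟨C, hC, h⟩ := h
  refine ⟨C, hC, fun Q hQ => ?_⟩
  have h0 := hμ.weightedVolume_ne_zero hQ
  have ht := hμ.weightedVolume_ne_top hQ
  set f : (Fin n → ℝ) → ℝ := Q.indicator (fun _ => (1 : ℝ)) with hf
  have hfp : ∀ x, ((f x : ℝ) : EReal).abs ^ p * ENNReal.ofReal (μ x) =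
      Q.indicator (fun x => ENNReal.ofReal (μ x)) x := by
    intro x
    by_cases hx : x ∈ Q
    · rw [ereal_abs_coe]
      simp [hf, hx]
    · simp [hf, hx, hp]
  have hle : ∀ x, ((f x : ℝ) : EReal).abs ^ p * ENNReal.ofReal (μ x) ≤ ENNReal.ofReal (μ x) :=
    fun x => by
      rw [hfp]
      exact indicator_le_self' (fun _ _ => zero_le) x
  have hnorm : morreyNorm p κ μ μ (fun x => (f x : EReal)) ≤
      weightedVolume μ Q ^ ((1 - κ) / p) := by
    rw [morreyNorm_le_iff hμ hp]
    intro R hR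
    have hI1 : ∫⁻ x in R, ((f x : ℝ) : EReal).abs ^ p * ENNReal.ofReal (μ x) ≤
        weightedVolume μ R := by
      rw [weightedVolume, withDensity_apply _ hR.measurableSet]
      exact lintegral_mono hle
    have hI2 : ∫⁻ x in R, ((f x : ℝ) : EReal).abs ^ p * ENNReal.ofReal (μ x) ≤
        weightedVolume μ Q := by
      rw [weightedVolume, withDensity_apply _ hQ.measurableSet,
        ← lintegral_indicator hQ.measurableSet, lintegral_congr hfp]
      exact setLIntegral_le_lintegral _ _
    calc _ = (∫⁻ x in R, ((f x : ℝ) : EReal).abs ^ p * ENNReal.ofReal (μ x)) ^ (1 - κ) *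
          (∫⁻ x in R, ((f x : ℝ) : EReal).abs ^ p * ENNReal.ofReal (μ x)) ^ κ := by
          rw [← ENNReal.rpow_add_of_nonneg _ _ (by linarith) hκ0.le]
          simp
      _ ≤ weightedVolume μ Q ^ (1 - κ) * weightedVolume μ R ^ κ := by
          gcongr
      _ = _ := by rw [← ENNReal.rpow_mul, div_mul_cancel₀ _ hp.ne']
  have hmem : MemMorrey p κ μ μ (fun x => (f x : EReal)) := by
    refine ⟨?_, fun K hK => ?_, hnorm.trans_lt ?_⟩
    · exact (measurable_const.indicator hQ.measurableSet).coe_real_ereal.aemeasurable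
    · exact (lintegral_mono hle).trans_lt
        (hμ.locallyIntegrable.integrableOn_isCompact hK).lintegral_lt_top
    · exact ENNReal.rpow_lt_top_of_nonneg (div_nonneg (by linarith) hp.le) ht
  have h1 := (h f hmem).2.trans (mul_le_mul_right hnorm _)
  rw [morreyNorm_le_iff hμ hq0] at h1
  rw [normalizedSize_le_iff hμ hq0 hQ, one_div, ENNReal.rpow_inv_le_iff hq0]
  refine le_trans (Eq.le ?_) ((h1 Q hQ).trans (Eq.le ?_))
  · exact setLIntegral_congr_fun hQ.measurableSet fun x hx => by
      simp only [hf, hQ.maximalCommutator_indicator b hx]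
  · rw [ENNReal.mul_rpow_of_nonneg _ _ hq0.le, ENNReal.mul_rpow_of_nonneg _ _ hq0.le, mul_assoc,
      ← ENNReal.rpow_mul, ← ENNReal.rpow_mul, ← ENNReal.rpow_add _ _ h0 ht]
    congr 2
    have : β / n + q⁻¹ = 1 / p := by rw [← one_div, hq]; ring
    rw [this]
    field_simp
    ring

/-! ### From the oscillation `b - M_Q(b)` to the Lipschitz condition -/

/-- Hölder's inequality on a cube with respect to the measure `μ(x) dx`. -/
theorem setLIntegral_abs_le_of_normalizedSize_le {μ : (Fin n → ℝ) → ℝ} (hμ : IsWeight μ)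
    {β q : ℝ} (hq : 1 < q) {Q : Set (Fin n → ℝ)} (hQ : IsCube Q) {g : (Fin n → ℝ) → EReal}
    (hg : AEMeasurable g (volume.restrict Q)) {L : ℝ≥0∞} (h : normalizedSize β q μ Q g ≤ L) :
    ∫⁻ x in Q, (g x).abs ≤ L * weightedVolume μ Q ^ (1 + β / n) := by
  have hq0 : 0 < q := by linarith
  have h0 := hμ.weightedVolume_ne_zero hQ
  have ht := hμ.weightedVolume_ne_top hQ
  rw [normalizedSize_le_iff hμ hq0 hQ] at h
  set k : (Fin n → ℝ) → ℝ≥0∞ := fun x => (g x).abs * (ENNReal.ofReal (μ x))⁻¹ with hk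
  have habs : Measurable EReal.abs :=
    EReal.measurable_of_measurable_real (by
      simp only [EReal.abs_def]
      fun_prop)
  have hkmeas : AEMeasurable k ((weightedVolume μ).restrict Q) := by
    have : AEMeasurable k (volume.restrict Q) :=
      (habs.comp_aemeasurable hg).mul hμ.aemeasurable.ennreal_ofReal.restrict.inv
    exact this.mono_ac ((withDensity_absolutelyContinuous _ _).restrict Q)
  have hpos : ∀ᵐ x ∂(volume.restrict Q), 0 < μ x := ae_restrict_of_ae hμ.ae_pos
  have h1 : ∫⁻ x in Q, (g x).abs = ∫⁻ x in Q, k x ∂weightedVolume μ := by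
    rw [hμ.setLIntegral_weightedVolume k hQ.measurableSet]
    refine lintegral_congr_ae ?_
    filter_upwards [hpos] with x hx
    rw [hk, mul_left_comm, ENNReal.mul_inv_cancel (by simpa using hx) ENNReal.ofReal_ne_top,
      mul_one]
  have h2 : ∫⁻ x in Q, k x ^ q ∂weightedVolume μ =
      ∫⁻ x in Q, (g x).abs ^ q * ENNReal.ofReal (μ x ^ (1 - q)) := by
    rw [hμ.setLIntegral_weightedVolume _ hQ.measurableSet]
    refine lintegral_congr_ae ?_
    filter_upwards [hpos] with x hx
    have hx' : ENNReal.ofReal (μ x) ≠ 0 := by simpa using hx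
    rw [hk, ENNReal.mul_rpow_of_nonneg _ _ hq0.le, mul_left_comm, ENNReal.inv_rpow,
      ← ENNReal.rpow_neg, ← ENNReal.ofReal_rpow_of_pos hx, sub_eq_add_neg,
      ENNReal.rpow_add _ _ hx' ENNReal.ofReal_ne_top, ENNReal.rpow_one]
  rw [h1]
  refine (setLIntegral_le_rpow_mul_measure_rpow _ hq hkmeas).trans ?_
  rw [h2]
  refine (mul_le_mul_left h _).trans_eq ?_
  rw [mul_assoc, ← ENNReal.rpow_add _ _ h0 ht]
  congr 2
  ring

theorem IsCube.setLIntegral_enorm_sub_average {b : (Fin n → ℝ) → ℝ}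
    (hb : LocallyIntegrable b volume) {Q : Set (Fin n → ℝ)} (hQ : IsCube Q) :
    ∫⁻ x in Q, ‖b x - ⨍ y in Q, b y‖ₑ = 2 * ∫⁻ x in Q, ENNReal.ofReal ((⨍ y in Q, b y) - b x) := by
  set a := ⨍ y in Q, b y with ha
  have hfin : IsFiniteMeasure (volume.restrict Q) := ⟨by simpa using hQ.volume_ne_top.lt_top⟩
  have hint : Integrable b (volume.restrict Q) := hb.integrableOn_isCompact hQ.isCompact
  have hint' : Integrable (fun x => b x - a) (volume.restrict Q) := hint.sub (integrable_const a)
  have hzero : ∫ x in Q, (b x - a) = 0 := integral_sub_average (volume.restrict Q) b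
  rw [integral_eq_lintegral_pos_part_sub_lintegral_neg_part hint', sub_eq_zero,
    ENNReal.toReal_eq_toReal_iff' hint'.lintegral_lt_top.ne
    (show Integrable (fun x => -(b x - a)) _ from hint'.neg).lintegral_lt_top.ne] at hzero
  have hsplit : ∀ t : ℝ, ‖t‖ₑ = ENNReal.ofReal t + ENNReal.ofReal (-t) := by
    intro t
    rcases le_total 0 t with h | h
    · rw [Real.enorm_of_nonneg h, ENNReal.ofReal_of_nonpos (neg_nonpos.2 h), add_zero]
    · rw [← enorm_neg, Real.enorm_of_nonneg (neg_nonneg.2 h), ENNReal.ofReal_of_nonpos h, zero_add]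
  simp_rw [hsplit]
  rw [lintegral_add_left' hint'.aemeasurable.ennreal_ofReal, hzero, two_mul]
  simp

/-- The oscillation `b - M_Q(b)` controls the oscillation of `b` on `Q`, since `b_Q ≤ M_Q(b)`, and
the negative part of `b`, since `0 ≤ M_Q(b)`. Lebesgue differentiation shows that the negative part
vanishes. -/
theorem memLip_and_nonneg_of_normalizedSize_le (hn : 0 < n) {b μ : (Fin n → ℝ) → ℝ} {β q : ℝ}
    (hb : LocallyIntegrable b volume) (hμ : IsA1 μ) (hβ : 0 < β) (hq : 1 < q) {C : ℝ≥0}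
    (h : ∀ Q : Set (Fin n → ℝ), IsCube Q → normalizedSize β q μ Q
      (fun x => (b x : EReal) - (localMaximalFunction Q b x : EReal)) ≤ C) :
    MemLip β μ b ∧ ∀ᵐ x, 0 ≤ b x := by
  have hw := hμ.isWeight
  have hγ : 0 < β / n := by positivity
  have hint : ∀ Q : Set (Fin n → ℝ), IsCube Q →
      ∫⁻ x in Q, ((b x : EReal) - (localMaximalFunction Q b x : EReal)).abs ≤
        C * weightedVolume μ Q ^ (1 + β / n) := by
    intro Q hQ
    refine setLIntegral_abs_le_of_normalizedSize_le hw hq hQ ?_ (h Q hQ)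
    refine (aemeasurable_maximalCommutator hb.aestronglyMeasurable.aemeasurable
      (Q.indicator fun _ => (1 : ℝ))).restrict.congr ?_
    filter_upwards [ae_restrict_mem hQ.measurableSet] with x hx
    exact hQ.maximalCommutator_indicator b hx
  refine ⟨⟨hb, ?_⟩, ?_⟩
  · refine lt_of_le_of_lt (b := ((2 * C : ℝ≥0) : ℝ≥0∞)) ?_ ENNReal.coe_lt_top
    refine iSup₂_le fun Q hQ => ?_
    rw [normalizedSize_one_sub_le_iff hw hQ, hQ.setLIntegral_enorm_sub_average hb]
    push_cast
    rw [mul_assoc]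
    gcongr 2 * ?_
    refine (setLIntegral_mono' hQ.measurableSet fun x hx => ?_).trans (hint Q hQ)
    refine ofReal_sub_le_abs_sub ?_
    refine le_trans ?_ (localMaximalFunction_le_iff.1 le_rfl Q hQ Subset.rfl hx)
    have h1 := hQ.enorm_setAverage_sub_le hb 0
    simp only [sub_zero] at h1
    exact Real.ofReal_le_enorm _ |>.trans h1
  · obtain ⟨A, hA⟩ := hμ.exists_a1Bound
    obtain ⟨η, hη, hrev⟩ := hA.exists_reverse_doubling hn hw
    have hbneg : LocallyIntegrable (fun x => max (-b x) 0) volume := by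
      intro x
      obtain ⟨s, hs, hbs⟩ := hb x
      exact ⟨s, hs, hbs.neg.pos_part⟩
    filter_upwards [ae_tendsto_average_shrunkCube hbneg, hA.ae_le] with x hx hxA
    set Q := closedBall x 1 with hQdef
    have hQ : IsCube Q := isCube_closedBall x one_pos
    have hxQ : x ∈ Q := mem_closedBall_self zero_le_one
    have hlim := (ENNReal.continuous_ofReal.tendsto _).comp (hx x 1 one_pos hxQ)
    have hbound : ∀ k, ENNReal.ofReal (⨍ y in shrunkCube x x 1 k, max (-b y) 0) ≤
        C * (A * ENNReal.ofReal (μ x)) * (η ^ k * weightedVolume μ Q) ^ (β / n) := by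
      intro k
      have hS := isCube_shrunkCube x x one_pos k
      refine (ENNReal.mul_le_mul_iff_left hS.volume_ne_zero hS.volume_ne_top).1 ?_
      rw [← hS.setLIntegral_ofReal hbneg fun y => le_max_right _ _]
      calc ∫⁻ y in shrunkCube x x 1 k, ENNReal.ofReal (max (-b y) 0)
          ≤ ∫⁻ y in shrunkCube x x 1 k,
            ((b y : EReal) - (localMaximalFunction (shrunkCube x x 1 k) b y : EReal)).abs := by
            refine lintegral_mono fun y => ?_
            have := ofReal_sub_le_abs_sub (t := b y) (a := 0)
              (m := localMaximalFunction (shrunkCube x x 1 k) b y) (by simp)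
            simpa using this
        _ ≤ C * weightedVolume μ (shrunkCube x x 1 k) ^ (1 + β / n) := hint _ hS
        _ = C * (weightedVolume μ (shrunkCube x x 1 k) *
            weightedVolume μ (shrunkCube x x 1 k) ^ (β / n)) := by
            rw [ENNReal.rpow_add_of_nonneg _ _ zero_le_one hγ.le, ENNReal.rpow_one]
        _ ≤ C * (A * ENNReal.ofReal (μ x) * volume (shrunkCube x x 1 k) *
            (η ^ k * weightedVolume μ Q) ^ (β / n)) := by
            gcongr
            · exact hxA _ hS (mem_shrunkCube hxQ k)
            · exact weightedVolume_shrunkCube_le hrev one_pos hxQ k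
        _ = _ := by ring
    have hzero : Filter.Tendsto (fun k : ℕ =>
        C * (A * ENNReal.ofReal (μ x)) * (η ^ k * weightedVolume μ Q) ^ (β / n))
        Filter.atTop (nhds 0) := by
      have h1 : Filter.Tendsto (fun k : ℕ => η ^ k * weightedVolume μ Q) Filter.atTop (nhds 0) := by
        simpa using ENNReal.Tendsto.mul_const
          (ENNReal.tendsto_pow_atTop_nhds_zero_of_lt_one hη)
          (Or.inr (hw.weightedVolume_ne_top hQ))
      have h2 := ((ENNReal.continuous_rpow_const (y := β / n)).tendsto 0).comp h1
      have h3 := ENNReal.Tendsto.const_mul (a := C * (A * ENNReal.ofReal (μ x))) h2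
        (Or.inr (by finiteness))
      simpa [ENNReal.zero_rpow_of_pos hγ] using h3
    have hle := le_of_tendsto_of_tendsto' hlim hzero hbound
    simpa using hle

/-! ### Boundedness of the commutator -/

/-- A nonnegative weighted Lipschitz function defines a commutator that is dominated pointwise by
the fractional maximal function, wherever the maximal function is finite. -/
theorem A1Bound.exists_abs_maximalCommutator_le (hn : 0 < n) {b μ : (Fin n → ℝ) → ℝ} {C : ℝ≥0}
    {β : ℝ} (h : A1Bound μ C) (hμ : IsWeight μ) (hβ : 0 < β) (hb : MemLip β μ b)
    (hb0 : ∀ᵐ x, 0 ≤ b x) : ∃ K : ℝ≥0, ∀ᵐ x, ∀ (f : (Fin n → ℝ) → ℝ) (g : (Fin n → ℝ) → ℝ≥0∞),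
      Measurable g → (∀ᵐ y, ‖f y‖ₑ = g y) → maximalFunction f x ≠ ∞ →
        (maximalCommutator b f x).abs ≤
          K * ENNReal.ofReal (μ x) * fractionalMaximal (weightedVolume μ) (β / n) g x := by
  obtain ⟨hbint, hL⟩ := hb
  have hγ : 0 < β / n := by positivity
  have hLip : ∀ Q : Set (Fin n → ℝ), IsCube Q → ∫⁻ y in Q, ‖b y - ⨍ z in Q, b z‖ₑ ≤
      lipNorm β 1 μ b * weightedVolume μ Q ^ (1 + β / n) := fun Q hQ =>
    (normalizedSize_one_sub_le_iff hμ hQ _).1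
      (le_iSup₂ (f := fun (Q : Set (Fin n → ℝ)) (_ : IsCube Q) =>
        normalizedSize β 1 μ Q (fun x => ((b x - ⨍ y in Q, b y : ℝ) : EReal))) Q hQ)
  obtain ⟨K, hK⟩ := h.exists_setLIntegral_enorm_sub_mul_le hn hμ hγ
  refine ⟨K * (lipNorm β 1 μ b).toNNReal, ?_⟩
  filter_upwards [hK b hbint _ hL.ne hLip, hb0] with x hx hbx f g hg hfg hfin
  rw [ENNReal.coe_mul, ENNReal.coe_toNNReal hL.ne]
  set U := K * lipNorm β 1 μ b * ENNReal.ofReal (μ x) *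
    fractionalMaximal (weightedVolume μ) (β / n) g x with hU
  have hbf : ∀ Q : Set (Fin n → ℝ), ∫⁻ y in Q, ‖b y * f y‖ₑ = ∫⁻ y in Q, ‖b y‖ₑ * g y :=
    fun Q => lintegral_congr_ae <| by
      filter_upwards [ae_restrict_of_ae hfg] with y hy
      rw [enorm_mul, hy]
  have hf : ∀ Q : Set (Fin n → ℝ), ∫⁻ y in Q, ‖f y‖ₑ = ∫⁻ y in Q, g y :=
    fun Q => lintegral_congr_ae (ae_restrict_of_ae hfg)
  have hbmeas : AEMeasurable (fun y => ‖b y‖ₑ) volume :=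
    hbint.aestronglyMeasurable.aemeasurable.enorm
  refine abs_coe_mul_sub_le hbx hfin ?_ ?_
  · refine maximalFunction_le_iff.2 fun Q hQ hxQ => ?_
    rw [ENNReal.div_le_iff hQ.volume_ne_zero hQ.volume_ne_top, hbf]
    calc ∫⁻ y in Q, ‖b y‖ₑ * g y ≤ ∫⁻ y in Q, (‖b x‖ₑ * g y + ‖b x - b y‖ₑ * g y) := by
          refine lintegral_mono fun y => ?_
          rw [← add_mul]
          gcongr
          simpa using enorm_sub_le (a := b x) (b := b x - b y)
      _ = ‖b x‖ₑ * (∫⁻ y in Q, g y) + ∫⁻ y in Q, ‖b x - b y‖ₑ * g y := by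
          rw [lintegral_add_left (by fun_prop), lintegral_const_mul _ hg]
      _ ≤ ‖b x‖ₑ * (maximalFunction f x * volume Q) + U * volume Q := by
          gcongr
          · rw [← hf, ← ENNReal.div_le_iff hQ.volume_ne_zero hQ.volume_ne_top]
            exact hQ.le_maximalFunction f hxQ
          · exact hx Q hQ hxQ g hg
      _ = _ := by ring
  · rw [maximalFunction, ENNReal.mul_iSup]
    refine iSup_le fun Q => ?_
    rw [ENNReal.mul_iSup]
    refine iSup_le fun hQ => ?_
    rw [ENNReal.mul_iSup]
    refine iSup_le fun hxQ => ?_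
    rw [← mul_div_assoc, ENNReal.div_le_iff hQ.volume_ne_zero hQ.volume_ne_top, hf]
    calc ‖b x‖ₑ * ∫⁻ y in Q, g y = ∫⁻ y in Q, ‖b x‖ₑ * g y := (lintegral_const_mul _ hg).symm
      _ ≤ ∫⁻ y in Q, (‖b y‖ₑ * g y + ‖b x - b y‖ₑ * g y) := by
          refine lintegral_mono fun y => ?_
          rw [← add_mul]
          gcongr
          simpa using enorm_add_le (b y) (b x - b y)
      _ = (∫⁻ y in Q, ‖b y * f y‖ₑ) + ∫⁻ y in Q, ‖b x - b y‖ₑ * g y := by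
          have hbg : AEMeasurable (fun y => ‖b y‖ₑ * g y) (volume.restrict Q) :=
            hbmeas.restrict.mul hg.aemeasurable
          rw [lintegral_add_left' hbg, hbf]
      _ ≤ maximalFunction (fun y => b y * f y) x * volume Q + U * volume Q := by
          gcongr
          · rw [← ENNReal.div_le_iff hQ.volume_ne_zero hQ.volume_ne_top]
            exact hQ.le_maximalFunction (fun y => b y * f y) hxQ
          · exact hx Q hQ hxQ g hg
      _ = _ := by ring

/-- Lebesgue averages are dominated by averages with respect to `μ(x) dx`. -/
theorem A1Bound.maximalFunction_le {μ : (Fin n → ℝ) → ℝ} {C : ℝ≥0} (h : A1Bound μ C)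
    (hμ : IsWeight μ) {f : (Fin n → ℝ) → ℝ} {g : (Fin n → ℝ) → ℝ≥0∞}
    (hfg : ∀ᵐ y, ‖f y‖ₑ = g y) (x : Fin n → ℝ) :
    maximalFunction f x ≤ C * fractionalMaximal (weightedVolume μ) 0 g x := by
  refine maximalFunction_le_iff.2 fun Q hQ hxQ => ?_
  have h0 := hμ.weightedVolume_ne_zero hQ
  have ht := hμ.weightedVolume_ne_top hQ
  rw [lintegral_congr_ae (ae_restrict_of_ae hfg),
    ENNReal.div_le_iff hQ.volume_ne_zero hQ.volume_ne_top]
  have h1 : (∫⁻ y in Q, g y ∂weightedVolume μ) / weightedVolume μ Q ≤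
      fractionalMaximal (weightedVolume μ) 0 g x := by
    obtain ⟨c, r, hr, rfl⟩ := hQ
    simpa using le_fractionalMaximal (weightedVolume μ) 0 g hr hxQ
  calc ∫⁻ y in Q, g y ≤
        C * volume Q * ((∫⁻ y in Q, g y ∂weightedVolume μ) / weightedVolume μ Q) := by
        rw [← mul_div_assoc, ENNReal.le_div_iff_mul_le (Or.inl h0) (Or.inl ht), mul_comm]
        exact h.weightedVolume_mul_setLIntegral_le hμ g hQ
    _ ≤ C * volume Q * fractionalMaximal (weightedVolume μ) 0 g x := by gcongr
    _ = _ := by ring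

/-- The pointwise bound by `μ` times the fractional maximal function turns the target weight
`μ ^ (1 - q)` into `μ`, so that the Morrey bound for the fractional maximal function applies. -/
theorem boundedOnMorrey_of_memLip (hn : 0 < n) {b μ : (Fin n → ℝ) → ℝ} {β p q κ : ℝ}
    (hμA : IsA1 μ) (hβ : 0 < β) (hp : 1 < p) (hpq : p ≤ q)
    (hq : 1 / q = 1 / p - β / n) (hκ0 : 0 < κ) (hκ : κ < p / q) (hb : MemLip β μ b)
    (hb0 : ∀ᵐ x, 0 ≤ b x) :
    BoundedOnMorrey (maximalCommutator b) p κ μ μ q (κ * q / p) (fun x => μ x ^ (1 - q)) μ := by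
  have hμ := hμA.isWeight
  have hp0 : 0 < p := by linarith
  have hq0 : 0 < q := by linarith
  obtain ⟨A, hA⟩ := hμA.exists_a1Bound
  have hdoubling := hA.isDoublingOnCubes hμ
  obtain ⟨K, hK⟩ := hA.exists_abs_maximalCommutator_le hn hμ hβ hb hb0
  obtain ⟨K₁, hK₁⟩ := IsDoublingOnCubes.exists_lintegral_fractionalMaximal_rpow_le (n := n)
    (D := A * 5 ^ n) hp hpq hq hκ0 hκ
  have hκ1 : κ < p / p := by
    rw [div_self hp0.ne']
    exact hκ.trans_le ((div_le_one hq0).2 hpq)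
  obtain ⟨K₀, hK₀⟩ := IsDoublingOnCubes.exists_lintegral_fractionalMaximal_rpow_le (n := n)
    (D := A * 5 ^ n) (α := 0) hp le_rfl (by ring) hκ0 hκ1
  set M : ℝ≥0 := K * K₁ ^ (1 / q) with hM
  refine ⟨M + 1, by positivity, fun f hf => ?_⟩
  set B := morreyNorm p κ μ μ (fun x => (f x : EReal)) with hB
  have hBtop : B ≠ ∞ := hf.norm_lt_top.ne
  have hfmeas : AEMeasurable f volume := by
    simpa using hf.aemeasurable.ereal_toReal
  -- A measurable representative of `|f|`; the maximal functions do not see the difference.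
  obtain ⟨g, hg, hfg⟩ := hfmeas.enorm
  have hfg : ∀ᵐ y, ‖f y‖ₑ = g y := hfg
  have hgB : ∀ (c : Fin n → ℝ) (r : ℝ), 0 < r → ∫⁻ y in closedBall c r, g y ^ p ∂weightedVolume μ ≤
      B ^ p * weightedVolume μ (closedBall c r) ^ κ := by
    intro c r hr
    have hQ := isCube_closedBall c hr
    refine le_trans (Eq.le ?_) ((morreyNorm_le_iff hμ hp0 μ _).1 hB.ge _ hQ)
    rw [hμ.setLIntegral_weightedVolume _ hQ.measurableSet]
    refine lintegral_congr_ae ?_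
    filter_upwards [ae_restrict_of_ae hfg] with y hy
    rw [ereal_abs_coe, hy, mul_comm]
  -- The bound for exponent zero makes `M(f)` locally `p`-integrable with respect to `μ(x) dx`.
  have hMfin : ∀ᵐ x, maximalFunction f x ≠ ∞ := by
    have h1 : ∀ k : ℕ, ∀ᵐ x ∂weightedVolume μ, x ∈ closedBall (0 : Fin n → ℝ) (k + 1) →
        maximalFunction f x ≠ ∞ := by
      intro k
      have hk : (0 : ℝ) < k + 1 := by positivity
      rw [← ae_restrict_iff' measurableSet_closedBall]
      have h2 : ∫⁻ x in closedBall (0 : Fin n → ℝ) (k + 1), maximalFunction f x ^ p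
          ∂weightedVolume μ ≠ ∞ := by
        refine ne_top_of_le_ne_top ?_ (lintegral_mono fun x =>
          ENNReal.rpow_le_rpow (hA.maximalFunction_le hμ hfg x) hp0.le)
        simp_rw [ENNReal.mul_rpow_of_nonneg _ _ hp0.le]
        rw [lintegral_const_mul' _ _ (by finiteness)]
        refine ENNReal.mul_ne_top (by finiteness) (ne_top_of_le_ne_top ?_
          (hK₀ _ hdoubling g hg B hBtop hgB 0 _ hk))
        have := hdoubling.ne_top (0 : Fin n → ℝ) (k + 1)
        finiteness
      filter_upwards [ae_lt_top ((measurable_maximalFunction f).pow_const p) h2] with x hx hx'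
      simp [hx', hp0] at hx
    filter_upwards [hμ.absolutelyContinuous (ae_all_iff.2 h1)] with x hx
    obtain ⟨k, hk⟩ := exists_nat_gt (dist x 0)
    exact hx k (mem_closedBall.2 (by linarith))
  have hbound : ∀ Q : Set (Fin n → ℝ), IsCube Q →
      ∫⁻ x in Q, (maximalCommutator b f x).abs ^ q * ENNReal.ofReal (μ x ^ (1 - q)) ≤
        (M * B) ^ q * weightedVolume μ Q ^ (κ * q / p) := by
    intro Q hQ
    calc _ ≤ ∫⁻ x in Q, K ^ q * (ENNReal.ofReal (μ x) *
            fractionalMaximal (weightedVolume μ) (β / n) g x ^ q) := by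
          refine lintegral_mono_ae (ae_restrict_of_ae ?_)
          filter_upwards [hK, hMfin, hμ.ae_pos] with x hx hfin hpos
          have hw : ENNReal.ofReal (μ x) ≠ 0 := by simpa using hpos
          calc _ ≤ (K * ENNReal.ofReal (μ x) *
                fractionalMaximal (weightedVolume μ) (β / n) g x) ^ q *
                ENNReal.ofReal (μ x ^ (1 - q)) := by
                gcongr
                exact hx f g hg hfg hfin
            _ = K ^ q * ((ENNReal.ofReal (μ x) ^ q * ENNReal.ofReal (μ x) ^ (1 - q)) *
                fractionalMaximal (weightedVolume μ) (β / n) g x ^ q) := by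
                rw [ENNReal.mul_rpow_of_nonneg _ _ hq0.le, ENNReal.mul_rpow_of_nonneg _ _ hq0.le,
                  ENNReal.ofReal_rpow_of_pos hpos (p := 1 - q)]
                ring
            _ = _ := by
                rw [← ENNReal.rpow_add _ _ hw ENNReal.ofReal_ne_top, add_sub_cancel,
                  ENNReal.rpow_one]
      _ = K ^ q * ∫⁻ x in Q, fractionalMaximal (weightedVolume μ) (β / n) g x ^ q
            ∂weightedVolume μ := by
          rw [lintegral_const_mul' _ _ (by finiteness),
            hμ.setLIntegral_weightedVolume _ hQ.measurableSet]
      _ ≤ K ^ q * (K₁ * (B ^ q * weightedVolume μ Q ^ (κ * q / p))) := by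
          gcongr
          obtain ⟨c, r, hr, rfl⟩ := hQ
          exact hK₁ _ hdoubling g hg B hBtop hgB c r hr
      _ = _ := by
          rw [hM, ENNReal.coe_mul, ENNReal.coe_rpow_of_nonneg _ (by positivity),
            ENNReal.mul_rpow_of_nonneg _ _ hq0.le, ENNReal.mul_rpow_of_nonneg _ _ hq0.le,
            ← ENNReal.rpow_mul, one_div_mul_cancel hq0.ne', ENNReal.rpow_one]
          ring
  have hnorm : morreyNorm q (κ * q / p) (fun x => μ x ^ (1 - q)) μ (maximalCommutator b f) ≤
      M * B := (morreyNorm_le_iff hμ hq0 _ _).2 hbound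
  refine ⟨⟨aemeasurable_maximalCommutator hb.1.aestronglyMeasurable.aemeasurable f,
    fun S hS => ?_, hnorm.trans_lt (by finiteness)⟩, hnorm.trans ?_⟩
  · obtain ⟨r, hr⟩ := hS.isBounded.subset_closedBall (0 : Fin n → ℝ)
    have hS' : S ⊆ closedBall 0 (max r 1) :=
      hr.trans (closedBall_subset_closedBall (le_max_left _ _))
    have hQ := isCube_closedBall (0 : Fin n → ℝ) (r := max r 1) (by positivity)
    have ht := hμ.weightedVolume_ne_top hQ
    refine ((lintegral_mono_set hS').trans (hbound _ hQ)).trans_lt ?_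
    finiteness
  · gcongr
    exact le_self_add

end WeightedMorrey

theorem theorem1p2 {n : ℕ} (b μ : (Fin n → ℝ) → ℝ) (β p q κ : ℝ)
    (hb : MeasureTheory.LocallyIntegrable b MeasureTheory.volume)
    (hμ : WeightedMorrey.IsA1 μ) (hβ0 : 0 < β) (hβ1 : β < 1)
    (hp1 : 1 < p) (hpn : p < n / β) (hq : 1 / q = 1 / p - β / n)
    (hκ0 : 0 < κ) (hκ1 : κ < p / q) :
    List.TFAE [
      WeightedMorrey.MemLip β μ b ∧ ∀ᵐ x, 0 ≤ b x,
      WeightedMorrey.BoundedOnMorrey (WeightedMorrey.maximalCommutator b)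
        p κ μ μ q (κ * q / p) (fun x => μ x ^ (1 - q)) μ,
      ∃ C : ℝ≥0, 0 < C ∧
        ⨆ (Q : Set (Fin n → ℝ)) (_ : WeightedMorrey.IsCube Q),
          WeightedMorrey.normalizedSize β q μ Q
            (fun x => (b x : EReal) - (WeightedMorrey.localMaximalFunction Q b x : EReal))
          ≤ (C : ℝ≥0∞)] := by
  have hp0 : 0 < p := by linarith
  -- For `n = 0` the condition `1 < p < n / β` fails.
  have hn : 0 < n := by
    rcases Nat.eq_zero_or_pos n with rfl | hn
    · simp at hpn
      linarith
    · exact hn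
  have hn' : (0 : ℝ) < n := by exact_mod_cast hn
  have hγ : 0 < β / n := by positivity
  have hq0 : 0 < q := by
    rw [← one_div_pos, hq, sub_pos, div_lt_div_iff₀ hn' hp0, one_mul, mul_comm]
    exact (lt_div_iff₀ hβ0).1 hpn
  have hpq : p < q := (one_div_lt_one_div hq0 hp0).1 (by linarith)
  tfae_have 1 → 2 := fun h => WeightedMorrey.boundedOnMorrey_of_memLip hn hμ hβ0 hp1 hpq.le hq hκ0
    hκ1 h.1 h.2
  tfae_have 2 → 3 := fun h => by
    obtain ⟨C, hC, h⟩ := WeightedMorrey.exists_normalizedSize_le_of_boundedOnMorrey hμ.isWeight hp0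
      hq0 hq hκ0 (hκ1.trans ((div_lt_one hq0).2 hpq)) h
    exact ⟨C, hC, iSup₂_le h⟩
  tfae_have 3 → 1 := fun ⟨C, _, h⟩ =>
    WeightedMorrey.memLip_and_nonneg_of_normalizedSize_le hn hb hμ hβ0 (by linarith)
      (iSup₂_le_iff.1 h)
  tfae_finish
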